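/- Let $\mathbb{R}_+=[0,\infty)$, $x_0>0$, $c_L,c_R>0$, and $c(x)=c_L$ for $x<x_0$, $c(x)=c_R$ for $x>x_0$. Let $u_0,v_0:\mathbb{R}_+\to\mathbb{C}$ be bounded, continuous almost everywhere, and zero in a neighbourhood of $0$. *Colombeau algebras.* For $q\ge 0$ let $\mathcal{A}_q$ be the set of $\chi\in\mathcal{D}(\mathbb{R})$ with $\int\chi=1$ and $\int x^k\chi(x)\,dx=0$ for $1\le k\le q$, and put $\chi_\varepsilon(x)=\varepsilon^{-1}\chi(x/\varepsilon)$. For $\Omega=\mathbb{R}_+$ or $\Omega=\mathbb{R}_+^2$ consider families $u=(u(\varphi,\cdot))_{\varphi\in\mathcal{A}_1}$ of complex functions that are $C^\infty$ on $\Omega$ up to the boundary. Such a family is moderate if for every compact $K\subset\Omega$ and every partial derivative $D$ there is $N$ such that $\sup_K|Du(\varphi_\varepsilon,\cdot)|=O(\varepsilon^{-N})$ as $\varepsilon\to0^+$ for all $\varphi\in\mathcal{A}_1\cap\mathcal{A}_N$; a moderate family is negligible if for all $K,D$ there is $N$ such that $\sup_K|Du(\varphi_\varepsilon,\cdot)|=O(\varepsilon^{q-N})$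 for all $q\ge N$ and $\varphi\in\mathcal{A}_1\cap\mathcal{A}_q$. $\mathcal{G}(\Omega)$ is the algebra of moderate families modulo negligible ones; derivatives, restrictions to the axes, and the embedding of functions of $x$ into functions of $(x,t)$ act on representatives. $U\in\mathcal{G}(\Omega)$ is associated with a locally integrable function $w$ on $\Omega$, written $U\approx w$, if it has a representative $u$ such that for every smooth compactly supported $\psi$ on $\mathbb{R}$, respectively $\mathbb{R}^2$, there is $N$ with $\lim_{\varepsilon\to0^+}\int_\Omega u(\varphi_\varepsilon,\cdot)\psi=\int_\Omega w\psi$ for all $\varphi\in\mathcal{A}_1\cap\mathcal{A}_N$. *Regularization.* Let $\rho\in\mathcal{D}(\mathbb{R})$ be real with $\int\rho=1$, and $\rho_\eta(x)=\eta^{-1}\rho(x/\eta)$; assume that the regularized speeds $c*\rho_\eta$, $\eta>0$, are strictly positive (as is the case if $\rho\ge0$). Here $c$ is extended by $c_L$ to the negative axis, and $u_0$, $v_0$ by $0$. Then the families $\varphi\mapsto c*\rho_{\eta(\varphi)}$, with $\eta(\varphi)=\bigl|\log \operatorname{diam}(\operatorname{supp}\varphi)\bigr|^{-1}$ (taken to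 be the zero function in the irrelevant case $\operatorname{diam}(\operatorname{supp}\varphi)=1$), $\varphi\mapsto u_0*\varphi$ and $\varphi\mapsto v_0*\varphi$ are moderate on $\mathbb{R}_+$. Their classes $C,U_0,V_0\in\mathcal{G}(\mathbb{R}_+)$ satisfy $C\approx c$, $U_0\approx u_0$, $V_0\approx v_0$. Moreover: * $C$ is globally bounded: it has a representative $\tilde c$ for which there is $N$ such that $\sup_{\mathbb{R}_+}|\tilde c(\varphi_\varepsilon,\cdot)|=O(1)$ as $\varepsilon\to0^+$ for all $\varphi\in\mathcal{A}_1\cap\mathcal{A}_N$. * $\partial_xC$ is of locally logarithmic growth: it has a representative $d$ such that for every compact $K\subset\mathbb{R}_+$ there is $N$ such that for all $\varphi\in\mathcal{A}_1\cap\mathcal{A}_N$ there is $a>0$ with $\sup_K|d(\varphi_\varepsilon,\cdot)|\le N\log(a/\varepsilon)$ for all small $\varepsilon>0$. * $U_0$ and $V_0$ have representatives all of whose members vanish near $0$ (compatibility conditions at the corner). The problem $$(\partial_t+C\,\partial_x)U=0,\quad(\partial_t-C\,\partial_x)V=0\ \text{ in }\mathcal{G}(\mathbb{R}_+^2),\qquad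 U(x,0)=U_0,\quad V(x,0)=V_0,\quad U(0,t)=V(0,t)\ \text{ in }\mathcal{G}(\mathbb{R}_+)$$ has exactly one solution $(U,V)\in\mathcal{G}(\mathbb{R}_+^2)\times\mathcal{G}(\mathbb{R}_+^2)$, and $$U\approx u,\qquad V\approx v,$$ where $(u,v)$ is the following classical solution. Let $\gamma_1(x,t,\cdot)$ and $\gamma_2(x,t,\cdot)$ be the connected (continuous, piecewise linear) characteristics of $c$ and $-c$ through $(x,t)$, and let $\Gamma$ be the characteristic of $c$ issuing from the origin. Then $v(x,t)=v_0(\gamma_2(x,t,0))$; on and below $\Gamma$, $u(x,t)=u_0(\gamma_1(x,t,0))$; above $\Gamma$, $u(x,t)=v(0,t_0)$, where $t_0$ is the time at which $\gamma_1(x,t,\cdot)$ meets the axis $x=0$. This pair takes the initial data $u_0,v_0$, satisfies $u(0,t)=v(0,t)$, is constant along the characteristics of each of the media $\{0\le x<x_0\}$ and $\{x>x_0\}$ ($u$ along those of $c$, $v$ along those of $-c$), and for almost every $t\ge 0$ the functions $u(\cdot,t)$, $v(\cdot,t)$ are continuous at $x_0$. -/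

import Mathlib

open Set Filter Topology MeasureTheory
open scoped ContDiff Convolution

namespace Colombeau

noncomputable section

/-! ### Mollifiers -/

/-- The set `A_q(ℝ)`: test functions with integral one whose moments of order `1, …, q` vanish. -/
structure IsMollifier (q : ℕ) (χ : ℝ → ℂ) : Prop where
  smooth : ContDiff ℝ ∞ χ
  compact : HasCompactSupport χ
  integral_one : ∫ x, χ x = 1
  moments : ∀ k : ℕ, 1 ≤ k → k ≤ q → ∫ x : ℝ, (x : ℂ) ^ k * χ x = 0

/-- The dilation `χ_ε(x) = ε⁻¹ χ(x / ε)`. -/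
def dilate (ε : ℝ) (χ : ℝ → ℂ) : ℝ → ℂ := fun x => (ε : ℂ)⁻¹ * χ (x / ε)

theorem IsMollifier.dilate {q : ℕ} {χ : ℝ → ℂ} (h : IsMollifier q χ) {ε : ℝ} (hε : 0 < ε) :
    IsMollifier q (dilate ε χ) := by
  have hne : (ε : ℂ) ≠ 0 := by exact_mod_cast hε.ne'
  refine ⟨?_, ?_, ?_, ?_⟩
  · exact contDiff_const.mul (h.smooth.comp (contDiff_id.div_const ε))
  · have h1 : HasCompactSupport (fun x : ℝ => χ (x / ε)) := by
      have := h.compact.comp_homeomorph (Homeomorph.mulRight₀ ε⁻¹ (inv_ne_zero hε.ne'))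
      simpa [Function.comp_def, div_eq_mul_inv] using this
    exact h1.mul_left
  · have := Measure.integral_comp_div (fun x => χ x) ε
    simp only [Colombeau.dilate, integral_const_mul, this, h.integral_one, abs_of_pos hε]
    simp [hne]
  · intro k hk hkq
    have h2 : (fun x : ℝ => (x : ℂ) ^ k * Colombeau.dilate ε χ x)
        = fun x : ℝ => ((ε : ℂ)⁻¹ * (ε : ℂ) ^ k) *
            ((fun y : ℝ => (y : ℂ) ^ k * χ y) (x / ε)) := by
      funext x
      simp only [Colombeau.dilate, Complex.ofReal_div, div_pow]
      field_simp
    rw [h2, integral_const_mul, Measure.integral_comp_div (fun y : ℝ => (y : ℂ) ^ k * χ y) ε,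
      h.moments k hk hkq]
    simp

/-- The index set `A_1`.  Since an element of `A_1(ℝᵐ)` is a tensor power `χ ⊗ ⋯ ⊗ χ` of a unique
`χ ∈ A_1(ℝ)`, and `(χ ⊗ ⋯ ⊗ χ)_ε = χ_ε ⊗ ⋯ ⊗ χ_ε`, we index by `χ` in all dimensions `m ≥ 1`. -/
def Index : Type := {χ : ℝ → ℂ // IsMollifier 1 χ}

/-- The index `φ_ε` (for `ε ≤ 0`, which is never used, it is `φ` itself). -/
def Index.scale (φ : Index) (ε : ℝ) : Index :=
  if h : 0 < ε then ⟨dilate ε φ.1, φ.2.dilate h⟩ else φ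

/-- The diameter of the support of the mollifier; the width of `φ_ε` is `ε` times that of `φ`. -/
def Index.width (φ : Index) : ℝ := Metric.diam (tsupport φ.1)

/-! ### The Colombeau algebra of a (closed) domain -/

/-- A subset of a normed space on which iterated derivatives up to the boundary are unambiguous. -/
structure Domain (E : Type*) [NormedAddCommGroup E] [NormedSpace ℝ E] where
  carrier : Set E
  uniqueDiff : UniqueDiffOn ℝ carrier

/-- `ℝ₊ = [0, ∞)`. -/
def halfLine : Domain ℝ := ⟨Ici 0, uniqueDiffOn_Ici 0⟩

/-- `ℝ₊² = [0, ∞) × [0, ∞)`; points are written `(x, t)`. -/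
def quadrant : Domain (ℝ × ℝ) :=
  ⟨Ici 0 ×ˢ Ici 0, (uniqueDiffOn_Ici 0).prod (uniqueDiffOn_Ici 0)⟩

section Algebra

variable {E : Type*} [NormedAddCommGroup E] [NormedSpace ℝ E]
variable {F : Type*} [NormedAddCommGroup F] [NormedSpace ℝ F]

/-- All functions `u(φ, ·)` are smooth on the domain, up to the boundary.  (Only the values on the
domain matter.) -/
def IsSmooth (Ω : Domain E) (u : Index → E → ℂ) : Prop :=
  ∀ φ, ContDiffOn ℝ ∞ (u φ) Ω.carrier

/-- `sup_K |D^k u(φ_ε, ·)| = O(ε ^ p)` as `ε → 0⁺`, where `D^k` is the full derivative of order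
`k` (i.e. all partial derivatives of order `k`). -/
def HasOrder (Ω : Domain E) (u : Index → E → ℂ) (K : Set E) (k : ℕ) (φ : Index) (p : ℤ) : Prop :=
  ∃ C : ℝ, ∀ᶠ ε in 𝓝[>] (0 : ℝ), ∀ x ∈ K,
    ‖iteratedFDerivWithin ℝ k (u (φ.scale ε)) Ω.carrier x‖ ≤ C * ε ^ p

/-- Moderate growth. -/
def IsModerate (Ω : Domain E) (u : Index → E → ℂ) : Prop :=
  ∀ K ⊆ Ω.carrier, IsCompact K → ∀ k : ℕ, ∃ N : ℕ, ∀ φ : Index, IsMollifier N φ.1 →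
    HasOrder Ω u K k φ (-(N : ℤ))

/-- Negligible growth. -/
def IsNegligible (Ω : Domain E) (u : Index → E → ℂ) : Prop :=
  ∀ K ⊆ Ω.carrier, IsCompact K → ∀ k : ℕ, ∃ N : ℕ, ∀ q : ℕ, N ≤ q →
    ∀ φ : Index, IsMollifier q φ.1 → HasOrder Ω u K k φ ((q : ℤ) - (N : ℤ))

theorem IsMollifier.mono {p q : ℕ} (hpq : p ≤ q) {χ : ℝ → ℂ} (h : IsMollifier q χ) :
    IsMollifier p χ :=
  ⟨h.smooth, h.compact, h.integral_one, fun k h1 h2 => h.moments k h1 (h2.trans hpq)⟩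

theorem HasOrder.nonneg {Ω : Domain E} {u : Index → E → ℂ} {K : Set E} {k : ℕ} {φ : Index}
    {p : ℤ} (h : HasOrder Ω u K k φ p) :
    ∃ C : ℝ, 0 ≤ C ∧ ∀ᶠ ε in 𝓝[>] (0 : ℝ), ∀ x ∈ K,
      ‖iteratedFDerivWithin ℝ k (u (φ.scale ε)) Ω.carrier x‖ ≤ C * ε ^ p := by
  obtain ⟨C, hC⟩ := h
  refine ⟨|C|, abs_nonneg C, ?_⟩
  filter_upwards [hC, self_mem_nhdsWithin] with ε h1 (hε : 0 < ε) x hx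
  refine (h1 x hx).trans ?_
  have : 0 < ε ^ p := zpow_pos hε p
  gcongr
  exact le_abs_self C

theorem HasOrder.mono {Ω : Domain E} {u : Index → E → ℂ} {K : Set E} {k : ℕ} {φ : Index}
    {p r : ℤ} (h : HasOrder Ω u K k φ p) (hr : r ≤ p) : HasOrder Ω u K k φ r := by
  obtain ⟨C, hC0, hC⟩ := h.nonneg
  refine ⟨C, ?_⟩
  have h1 : ∀ᶠ ε in 𝓝[>] (0 : ℝ), ε < 1 :=
    (eventually_lt_nhds zero_lt_one).filter_mono nhdsWithin_le_nhds
  filter_upwards [hC, h1, self_mem_nhdsWithin] with ε h2 h3 (hε : 0 < ε) x hx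
  refine (h2 x hx).trans ?_
  gcongr 1
  exact zpow_le_zpow_right_of_le_one₀ hε h3.le hr

theorem HasOrder.add {Ω : Domain E} {u v : Index → E → ℂ} (hu : IsSmooth Ω u)
    (hv : IsSmooth Ω v) {K : Set E} (hK : K ⊆ Ω.carrier) {k : ℕ} {φ : Index} {p : ℤ}
    (h : HasOrder Ω u K k φ p) (h' : HasOrder Ω v K k φ p) : HasOrder Ω (u + v) K k φ p := by
  obtain ⟨C, hC⟩ := h
  obtain ⟨C', hC'⟩ := h'
  refine ⟨C + C', ?_⟩
  filter_upwards [hC, hC'] with ε h1 h2 x hx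
  have hx' := hK hx
  have e : iteratedFDerivWithin ℝ k ((u + v) (φ.scale ε)) Ω.carrier x
      = iteratedFDerivWithin ℝ k (u (φ.scale ε)) Ω.carrier x
        + iteratedFDerivWithin ℝ k (v (φ.scale ε)) Ω.carrier x :=
    iteratedFDerivWithin_add_apply
      (((hu _).of_le (by exact_mod_cast le_top)) x hx')
      (((hv _).of_le (by exact_mod_cast le_top)) x hx') Ω.uniqueDiff hx'
  rw [e, add_mul]
  exact (norm_add_le _ _).trans (add_le_add (h1 x hx) (h2 x hx))

theorem HasOrder.mul {Ω : Domain E} {u v : Index → E → ℂ} (hu : IsSmooth Ω u)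
    (hv : IsSmooth Ω v) {K : Set E} (hK : K ⊆ Ω.carrier) {k : ℕ} {φ : Index} {p r : ℤ}
    (h : ∀ i ≤ k, HasOrder Ω u K i φ p) (h' : ∀ i ≤ k, HasOrder Ω v K i φ r) :
    HasOrder Ω (u * v) K k φ (p + r) := by
  have H := fun i : Fin (k + 1) => (h i (Nat.lt_succ_iff.1 i.2)).nonneg
  have H' := fun i : Fin (k + 1) => (h' (k - i) (Nat.sub_le _ _)).nonneg
  choose C hC0 hC using H
  choose C' hC0' hC' using H'
  refine ⟨∑ i : Fin (k + 1), (k.choose i : ℝ) * C i * C' i, ?_⟩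
  filter_upwards [eventually_all.2 hC, eventually_all.2 hC', self_mem_nhdsWithin]
    with ε h1 h2 (hε : 0 < ε) x hx
  have hx' := hK hx
  have e := norm_iteratedFDerivWithin_mul_le (hu (φ.scale ε)) (hv (φ.scale ε)) Ω.uniqueDiff hx'
    (n := k) (by exact_mod_cast le_top)
  refine e.trans ?_
  rw [Finset.sum_range, Finset.sum_mul]
  refine Finset.sum_le_sum fun i _ => ?_
  have a1 := h1 i x hx
  have a2 := h2 i x hx
  have p1 : 0 < ε ^ p := zpow_pos hε p
  calc _ ≤ (k.choose i : ℝ) * (C i * ε ^ p) * (C' i * ε ^ r) := by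
        have := hC0 i
        gcongr
    _ = _ := by rw [zpow_add₀ hε.ne']; ring

theorem HasOrder.of_const {Ω : Domain E} {f : E → ℂ} (hf : ContDiffOn ℝ ∞ f Ω.carrier) {K : Set E}
    (hK : K ⊆ Ω.carrier) (hKc : IsCompact K) (k : ℕ) (φ : Index) :
    HasOrder Ω (fun _ => f) K k φ 0 := by
  have hc : ContinuousOn (iteratedFDerivWithin ℝ k f Ω.carrier) K :=
    (hf.continuousOn_iteratedFDerivWithin (by exact_mod_cast le_top) Ω.uniqueDiff).mono hK
  obtain ⟨C, hC⟩ := hKc.exists_bound_of_continuousOn hc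
  exact ⟨C, Eventually.of_forall fun ε x hx => by simpa using hC x hx⟩

theorem IsModerate.uniform {Ω : Domain E} {u : Index → E → ℂ} (h : IsModerate Ω u) {K : Set E}
    (hK : K ⊆ Ω.carrier) (hKc : IsCompact K) (k : ℕ) :
    ∃ N : ℕ, ∀ M, N ≤ M → ∀ φ : Index, IsMollifier M φ.1 → ∀ i ≤ k,
      HasOrder Ω u K i φ (-(N : ℤ)) := by
  choose N hN using fun i => h K hK hKc i
  refine ⟨(Finset.range (k + 1)).sup N, fun M hM φ hφ i hi => ?_⟩
  have h1 : N i ≤ (Finset.range (k + 1)).sup N :=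
    Finset.le_sup (Finset.mem_range.2 (Nat.lt_succ_iff.2 hi))
  exact (hN i φ (hφ.mono (h1.trans hM))).mono (by omega)

theorem IsNegligible.uniform {Ω : Domain E} {u : Index → E → ℂ} (h : IsNegligible Ω u) {K : Set E}
    (hK : K ⊆ Ω.carrier) (hKc : IsCompact K) (k : ℕ) :
    ∃ N : ℕ, ∀ q : ℕ, N ≤ q → ∀ φ : Index, IsMollifier q φ.1 → ∀ i ≤ k,
      HasOrder Ω u K i φ ((q : ℤ) - (N : ℤ)) := by
  choose N hN using fun i => h K hK hKc i
  refine ⟨(Finset.range (k + 1)).sup N, fun q hq φ hφ i hi => ?_⟩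
  have h1 : N i ≤ (Finset.range (k + 1)).sup N :=
    Finset.le_sup (Finset.mem_range.2 (Nat.lt_succ_iff.2 hi))
  exact (hN i q (h1.trans hq) φ hφ).mono (by omega)

/-- The algebra `E_M[Ω]` of moderate elements. -/
def Moderate (Ω : Domain E) : Subalgebra ℂ (Index → E → ℂ) where
  carrier := {u | IsSmooth Ω u ∧ IsModerate Ω u}
  mul_mem' := by
    rintro u v ⟨hu, hu'⟩ ⟨hv, hv'⟩
    refine ⟨fun φ => (hu φ).mul (hv φ), fun K hK hKc k => ?_⟩
    obtain ⟨N, hN⟩ := hu'.uniform hK hKc k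
    obtain ⟨M, hM⟩ := hv'.uniform hK hKc k
    refine ⟨N + M, fun φ hφ => ?_⟩
    have := HasOrder.mul hu hv hK (hN _ (Nat.le_add_right N M) φ hφ)
      (hM _ (Nat.le_add_left M N) φ hφ)
    exact this.mono (by push_cast; omega)
  add_mem' := by
    rintro u v ⟨hu, hu'⟩ ⟨hv, hv'⟩
    refine ⟨fun φ => (hu φ).add (hv φ), fun K hK hKc k => ?_⟩
    obtain ⟨N, hN⟩ := hu'.uniform hK hKc k
    obtain ⟨M, hM⟩ := hv'.uniform hK hKc k
    refine ⟨N + M, fun φ hφ => ?_⟩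
    exact HasOrder.add hu hv hK
      ((hN _ (Nat.le_add_right N M) φ hφ k le_rfl).mono (by push_cast; omega))
      ((hM _ (Nat.le_add_left M N) φ hφ k le_rfl).mono (by push_cast; omega))
  algebraMap_mem' := by
    intro r
    refine ⟨fun φ => contDiffOn_const, fun K hK hKc k => ⟨0, fun φ _ => ?_⟩⟩
    exact HasOrder.of_const (Ω := Ω) (f := fun _ => r) contDiffOn_const hK hKc k φ

/-- The ideal `N[Ω]` of negligible elements of `E_M[Ω]`. -/
def Negligible (Ω : Domain E) : Ideal (Moderate Ω) where
  carrier := {u | IsNegligible Ω u.1}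
  zero_mem' := by
    intro K hK hKc k
    refine ⟨0, fun q _ φ _ => ⟨0, Eventually.of_forall fun ε x hx => ?_⟩⟩
    have : ((0 : Moderate Ω).1 (φ.scale ε)) = 0 := rfl
    simp [this]
  add_mem' := by
    intro u v hu hv K hK hKc k
    obtain ⟨N, hN⟩ := hu K hK hKc k
    obtain ⟨M, hM⟩ := hv K hK hKc k
    refine ⟨N + M, fun q hq φ hφ => ?_⟩
    exact HasOrder.add u.2.1 v.2.1 hK ((hN q (by omega) φ hφ).mono (by push_cast; omega))
      ((hM q (by omega) φ hφ).mono (by push_cast; omega))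
  smul_mem' := by
    intro u v hv K hK hKc k
    obtain ⟨N, hN⟩ := u.2.2.uniform hK hKc k
    obtain ⟨M, hM⟩ := IsNegligible.uniform hv hK hKc k
    refine ⟨N + M, fun q hq φ hφ => ?_⟩
    have := HasOrder.mul u.2.1 v.2.1 hK (hN q (by omega) φ hφ) (hM q (by omega) φ hφ)
    exact this.mono (by push_cast; omega)

/-- The Colombeau algebra `G(Ω) = E_M[Ω] / N[Ω]`. -/
abbrev G (Ω : Domain E) : Type _ := Moderate Ω ⧸ Negligible Ω

/-- `u` is a representative of the generalized function `U`. -/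
def IsRep {Ω : Domain E} (u : Index → E → ℂ) (U : G Ω) : Prop :=
  ∃ h : u ∈ Moderate Ω, Ideal.Quotient.mk (Negligible Ω) ⟨u, h⟩ = U

/-! ### Differentiation, pull-back along linear maps -/

theorem IsSmooth.deriv {Ω : Domain E} {u : Index → E → ℂ} (hu : IsSmooth Ω u) (e : E) :
    IsSmooth Ω (fun φ x => fderivWithin ℝ (u φ) Ω.carrier x e) := fun φ =>
  ((contDiffOn_infty_iff_fderivWithin Ω.uniqueDiff).1 (hu φ)).2.clm_apply contDiffOn_const

theorem HasOrder.deriv {Ω : Domain E} {u : Index → E → ℂ} (hu : IsSmooth Ω u) (e : E)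
    {K : Set E} (hK : K ⊆ Ω.carrier) {k : ℕ} {φ : Index} {p : ℤ}
    (h : HasOrder Ω u K (k + 1) φ p) :
    HasOrder Ω (fun φ x => fderivWithin ℝ (u φ) Ω.carrier x e) K k φ p := by
  obtain ⟨C, hC⟩ := h
  refine ⟨‖e‖ * C, ?_⟩
  filter_upwards [hC] with ε h1 x hx
  have hx' := hK hx
  have h2 := norm_iteratedFDerivWithin_clm_apply_const (c := e) (n := k) (N := ∞)
    (((contDiffOn_infty_iff_fderivWithin Ω.uniqueDiff).1 (hu (φ.scale ε))).2 x hx')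
    Ω.uniqueDiff hx' (by exact_mod_cast le_top)
  rw [norm_iteratedFDerivWithin_fderivWithin Ω.uniqueDiff hx'] at h2
  refine h2.trans ?_
  rw [mul_assoc]
  exact mul_le_mul_of_nonneg_left (h1 x hx) (norm_nonneg e)

theorem HasOrder.congr {Ω : Domain E} {u v : Index → E → ℂ} {K : Set E} (hK : K ⊆ Ω.carrier)
    {k : ℕ} {φ : Index} {p : ℤ} (h : HasOrder Ω u K k φ p)
    (huv : ∀ φ, EqOn (v φ) (u φ) Ω.carrier) : HasOrder Ω v K k φ p := by
  obtain ⟨C, hC⟩ := h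
  refine ⟨C, ?_⟩
  filter_upwards [hC] with ε h1 x hx
  rw [iteratedFDerivWithin_congr (huv _) (hK hx)]
  exact h1 x hx

/-- Derivative of a moderate element in the direction `e`. -/
def derivModerate (Ω : Domain E) (e : E) (u : Moderate Ω) : Moderate Ω :=
  ⟨fun φ x => fderivWithin ℝ (u.1 φ) Ω.carrier x e, u.2.1.deriv e, fun K hK hKc k => by
    obtain ⟨N, hN⟩ := u.2.2 K hK hKc (k + 1)
    exact ⟨N, fun φ hφ => (hN φ hφ).deriv u.2.1 e hK⟩⟩

/-- The derivative `∂_e : G(Ω) → G(Ω)` in the direction `e`, acting on representatives. -/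
def deriv {Ω : Domain E} (e : E) : G Ω → G Ω :=
  Quotient.map' (derivModerate Ω e) (by
    intro u v huv
    rw [Submodule.quotientRel_def] at huv ⊢
    intro K hK hKc k
    obtain ⟨N, hN⟩ := huv K hK hKc (k + 1)
    refine ⟨N, fun q hq φ hφ => ?_⟩
    refine ((hN q hq φ hφ).deriv (u - v).2.1 e hK).congr hK fun ψ x hx => ?_
    have h1 := (u.2.1 ψ).differentiableOn (by simp) x hx
    have h2 := (v.2.1 ψ).differentiableOn (by simp) x hx
    have h3 := fderivWithin_sub (Ω.uniqueDiff x hx) h1 h2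
    have h4 := congrArg (fun L : E →L[ℝ] ℂ => L e) h3
    exact h4.symm)

theorem HasOrder.comp {Ω : Domain E} {Ω' : Domain F} {u : Index → F → ℂ} (hu : IsSmooth Ω' u)
    (L : E →L[ℝ] F) (hL : MapsTo L Ω.carrier Ω'.carrier) {K : Set E} (hK : K ⊆ Ω.carrier)
    {k : ℕ} {φ : Index} {p : ℤ} (h : HasOrder Ω' u (L '' K) k φ p) :
    HasOrder Ω (fun φ x => u φ (L x)) K k φ p := by
  obtain ⟨C, hC⟩ := h
  refine ⟨C * ‖L‖ ^ k, ?_⟩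
  filter_upwards [hC] with ε h1 x hx
  have h2 := (((hu (φ.scale ε)).ftaylorSeriesWithin Ω'.uniqueDiff).compContinuousLinearMap L).mono
    hL
  have h3 := h2.eq_iteratedFDerivWithin_of_uniqueDiffOn (m := k) (by exact_mod_cast le_top)
    Ω.uniqueDiff (hK hx)
  have h4 : iteratedFDerivWithin ℝ k (fun x => u (φ.scale ε) (L x)) Ω.carrier x = _ := h3.symm
  rw [h4]
  refine (ContinuousMultilinearMap.norm_compContinuousLinearMap_le _ _).trans ?_
  have h5 := h1 (L x) (mem_image_of_mem L hx)
  rw [Finset.prod_const, Finset.card_univ, Fintype.card_fin, mul_right_comm]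
  exact mul_le_mul_of_nonneg_right h5 (by positivity)

/-- Pull-back `u ↦ u ∘ L` of moderate elements. -/
def pullModerate {Ω : Domain E} {Ω' : Domain F} (L : E →L[ℝ] F)
    (hL : MapsTo L Ω.carrier Ω'.carrier) : Moderate Ω' →+* Moderate Ω where
  toFun u := ⟨fun φ x => u.1 φ (L x), fun φ => (u.2.1 φ).comp L.contDiff.contDiffOn hL,
    fun K hK hKc k => by
      obtain ⟨N, hN⟩ := u.2.2 (L '' K) (hL.mono_left hK).image_subset (hKc.image L.continuous) k
      exact ⟨N, fun φ hφ => (hN φ hφ).comp u.2.1 L hL hK⟩⟩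
  map_one' := rfl
  map_mul' _ _ := rfl
  map_zero' := rfl
  map_add' _ _ := rfl

/-- Pull-back `G(Ω') → G(Ω)` along a linear map of `Ω` into `Ω'`, acting on representatives. -/
def pull {Ω : Domain E} {Ω' : Domain F} (L : E →L[ℝ] F)
    (hL : MapsTo L Ω.carrier Ω'.carrier) : G Ω' →+* G Ω :=
  Ideal.quotientMap (Negligible Ω) (pullModerate L hL) (by
    intro u hu K hK hKc k
    obtain ⟨N, hN⟩ := hu (L '' K) (hL.mono_left hK).image_subset (hKc.image L.continuous) k
    exact ⟨N, fun q hq φ hφ => (hN q hq φ hφ).comp u.2.1 L hL hK⟩)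

/-! ### Growth conditions and association -/

/-- `U` is globally bounded. -/
def GloballyBounded {Ω : Domain E} (U : G Ω) : Prop :=
  ∃ u, IsRep u U ∧ ∃ N : ℕ, ∀ φ : Index, IsMollifier N φ.1 → ∃ c > 0,
    ∀ᶠ ε in 𝓝[>] (0 : ℝ), ∀ y ∈ Ω.carrier, ‖u (φ.scale ε) y‖ ≤ c

/-- `U` is of locally logarithmic growth. -/
def LocallyLogGrowth {Ω : Domain E} (U : G Ω) : Prop :=
  ∃ u, IsRep u U ∧ ∀ K ⊆ Ω.carrier, IsCompact K → ∃ N : ℕ, ∀ φ : Index, IsMollifier N φ.1 →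
    ∃ c > 0, ∀ᶠ ε in 𝓝[>] (0 : ℝ), ∀ y ∈ K, ‖u (φ.scale ε) y‖ ≤ N * Real.log (c / ε)

/-- `U ≈ w`: the function `w` is locally integrable on the domain, and `U` is associated with the
distribution it defines.  The test functions are the restrictions to the domain of smooth compactly
supported functions on the whole space (they need not vanish at the boundary). -/
def IsAssociated [MeasureSpace E] {Ω : Domain E} (U : G Ω) (w : E → ℂ) : Prop :=
  LocallyIntegrableOn w Ω.carrier ∧
    ∃ u, IsRep u U ∧ ∀ ψ : E → ℂ, ContDiff ℝ ∞ ψ → HasCompactSupport ψ →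
      ∃ N : ℕ, ∀ φ : Index, IsMollifier N φ.1 →
        Tendsto (fun ε : ℝ => ∫ x in Ω.carrier, u (φ.scale ε) x * ψ x) (𝓝[>] 0)
          (𝓝 (∫ x in Ω.carrier, w x * ψ x))

end Algebra

/-! ### The wave system in `G(ℝ₊²)` -/

/-- `∂_x`. -/
def dx : G quadrant → G quadrant := deriv ((1, 0) : ℝ × ℝ)

/-- `∂_t`. -/
def dt : G quadrant → G quadrant := deriv ((0, 1) : ℝ × ℝ)

/-- A generalized function of `x` seen as a generalized function of `(x, t)`. -/
def ofX : G halfLine →+* G quadrant :=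
  pull (ContinuousLinearMap.fst ℝ ℝ ℝ) (fun _ hp => hp.1)

/-- The restriction `U(x, 0)`. -/
def atTimeZero : G quadrant →+* G halfLine :=
  pull (ContinuousLinearMap.inl ℝ ℝ ℝ) (fun _ hx => ⟨hx, le_refl (0 : ℝ)⟩)

/-- The restriction `U(0, t)`. -/
def atBoundary : G quadrant →+* G halfLine :=
  pull (ContinuousLinearMap.inr ℝ ℝ ℝ) (fun _ ht => ⟨le_refl (0 : ℝ), ht⟩)

/-- `(U, V)` solves the wave system with speed `C`, initial data `U₀`, `V₀` and the boundary
condition `U(0, t) = V(0, t)`. -/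
structure IsSolution (C U₀ V₀ : G halfLine) (U V : G quadrant) : Prop where
  eq_u : dt U + ofX C * dx U = 0
  eq_v : dt V - ofX C * dx V = 0
  initial_u : atTimeZero U = U₀
  initial_v : atTimeZero V = V₀
  boundary : atBoundary U = atBoundary V

/-- `U` has a representative each of whose members is nil in a neighbourhood of `0` in `ℝ₊`.  For
both initial data this gives the compatibility conditions (of every order) at the corner. -/
def NilNearZero (U : G halfLine) : Prop :=
  ∃ u, IsRep u U ∧ ∀ φ, ∃ δ > 0, ∀ x : ℝ, 0 ≤ x → x < δ → u φ x = 0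

/-! ### The regularized coefficient and data -/

/-- The piecewise constant speed (extended by `c_L` to the negative axis). -/
def speed (cL cR x₀ : ℝ) : ℝ → ℝ := fun x => if x < x₀ then cL else cR

/-- The regularization `c * ρ_η` of a locally integrable function, `ρ_η(x) = η⁻¹ ρ(x / η)`. -/
def smear (c ρ : ℝ → ℝ) (η : ℝ) : ℝ → ℝ :=
  c ⋆[ContinuousLinearMap.mul ℝ ℝ, volume] (fun x => η⁻¹ * ρ (x / η))

/-- The logarithmic scale `η = |log ε|⁻¹`, the parameter `ε` being the width of the mollifier. -/
def logScale (φ : Index) : ℝ := |Real.log φ.width|⁻¹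

/-- The representative `c * ρ_η`, `η = |log ε|⁻¹`, of the generalized speed. -/
def speedRep (c ρ : ℝ → ℝ) : Index → ℝ → ℂ := fun φ x => (smear c ρ (logScale φ) x : ℂ)

/-- The representative `φ ↦ w * φ` of a function `w` on `ℝ₊`, extended by `0`. -/
def dataRep (w : ℝ → ℂ) : Index → ℝ → ℂ := fun φ =>
  (Ici (0 : ℝ)).indicator w ⋆[ContinuousLinearMap.mul ℝ ℂ, volume] φ.1

/-! ### The classical solution -/

/-- Time `∫₀ˣ dy / c(y)` needed to travel from `0` to `x`. -/
def travelTime (cL cR x₀ x : ℝ) : ℝ :=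
  if x ≤ x₀ then x / cL else x₀ / cL + (x - x₀) / cR

/-- The inverse function of the travel time. -/
def position (cL cR x₀ s : ℝ) : ℝ :=
  if s ≤ x₀ / cL then cL * s else x₀ + cR * (s - x₀ / cL)

/-- Value at time `τ` of the connected characteristic of the speed `c` through `(x, t)`. -/
def γ₁ (cL cR x₀ x t τ : ℝ) : ℝ := position cL cR x₀ (travelTime cL cR x₀ x + (τ - t))

/-- Value at time `τ` of the connected characteristic of the speed `-c` through `(x, t)`. -/
def γ₂ (cL cR x₀ x t τ : ℝ) : ℝ := position cL cR x₀ (travelTime cL cR x₀ x - (τ - t))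

/-- `v(x, t) = v₀(γ₂(x, t, 0))`. -/
def classicalV (cL cR x₀ : ℝ) (v₀ : ℝ → ℂ) : ℝ × ℝ → ℂ :=
  fun p => v₀ (γ₂ cL cR x₀ p.1 p.2 0)

/-- `u(x, t) = u₀(γ₁(x, t, 0))` below the characteristic from the origin, and `v(0, t₀)` above it,
where `t₀` is the time at which `γ₁` through `(x, t)` meets the axis `x = 0`. -/
def classicalU (cL cR x₀ : ℝ) (u₀ v₀ : ℝ → ℂ) : ℝ × ℝ → ℂ := fun p =>
  if p.2 ≤ travelTime cL cR x₀ p.1 then u₀ (γ₁ cL cR x₀ p.1 p.2 0)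
  else classicalV cL cR x₀ v₀ (0, p.2 - travelTime cL cR x₀ p.1)

/-- `(u, v)` is a classical solution (in the sense of characteristics: `u`, `v` are constant along
the characteristics of each medium) in `{0 ≤ x < x₀}` and in `{x > x₀}`, with the initial and
boundary conditions, and with `u` and `v` continuous at `x = x₀` (for almost every time, the data
being continuous only almost everywhere). -/
structure IsTransmissionSolution (cL cR x₀ : ℝ) (u₀ v₀ : ℝ → ℂ) (u v : ℝ × ℝ → ℂ) : Prop where
  left_u : ∀ x t s : ℝ, 0 ≤ x → 0 ≤ t → 0 ≤ s → x + cL * s < x₀ → u (x + cL * s, t + s) = u (x, t)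
  right_u : ∀ x t s : ℝ, x₀ < x → 0 ≤ t → 0 ≤ s → u (x + cR * s, t + s) = u (x, t)
  left_v : ∀ x t s : ℝ, 0 ≤ x → 0 ≤ t → 0 ≤ s → x + cL * s < x₀ → v (x, t + s) = v (x + cL * s, t)
  right_v : ∀ x t s : ℝ, x₀ < x → 0 ≤ t → 0 ≤ s → v (x, t + s) = v (x + cR * s, t)
  initial_u : ∀ x : ℝ, 0 ≤ x → u (x, 0) = u₀ x
  initial_v : ∀ x : ℝ, 0 ≤ x → v (x, 0) = v₀ x
  boundary : ∀ t : ℝ, 0 ≤ t → u (0, t) = v (0, t)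
  continuous_u : ∀ᵐ t ∂volume.restrict (Ici (0 : ℝ)), ContinuousAt (fun x => u (x, t)) x₀
  continuous_v : ∀ᵐ t ∂volume.restrict (Ici (0 : ℝ)), ContinuousAt (fun x => v (x, t)) x₀

end

end Colombeau

/-!
The regularized speed is smooth, so for every mollifier the characteristics are honest curves, and
with `T` the travel time of the regularized speed `κ` and `P` its inverse function the system is
solved explicitly by the simple waves `V = e (P (T x + t))` and
`U = d (P (T x - t)) + e (P (t - T x))` (`wave`), where `d` and `e` are the regularized data; these
vanish near the origin and on the negative axis, after a change that does not affect their classes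
(`cutData`), so that `U` is smooth and satisfies the boundary condition.

That these waves are moderate, and that solutions are unique, is one and the same estimate
(`growth_of_leftward`, `growth_of_rightward`): if `∂ₜ z + σ κ ∂ₓ z`, the initial values and, for
`σ = 1`, the boundary values of `z` are moderate, respectively negligible, then so is `z`.  The
predicate `Growth` covers both cases.  For `z` itself the estimate follows by integration along
characteristics, which stay in a compact set because `κ` is bounded.  For the derivatives note that
`κ ∂ₓ` commutes with `∂ₜ + σ κ ∂ₓ`, so that `κ ∂ₓ z` satisfies the same hypotheses, and that `1 / κ`
is moderate, so that `∂ₓ z`, and then `∂ₜ z`, are recovered (`growth_of_stable`).  No Gronwall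
argument for the derivatives is needed.

The discontinuous speed is invariant under dilations about the interface, so all regularized speeds
take the values of one positive function that is constant outside a compact interval; hence they
have uniform positive bounds (`IsRegularizer.exists_isSpeed`).  Therefore the travel times converge,
and since their inverse functions are uniformly Lipschitz continuous the characteristics converge
too (`IsMedium.tendsto_charTime`, `IsMedium.tendsto_charPos`).  At points of continuity the
regularized data converge along converging arguments (`tendsto_convolution_dilate`), and
characteristics pull null sets back to null sets, so the waves converge almost everywhere to the
classical solution while staying bounded; dominated convergence gives the association
(`isAssociated_of_tendsto`).
-/

namespace Colombeau

noncomputable section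

/-! ### Growth classes -/

section Growth

variable {E : Type*} [NormedAddCommGroup E] [NormedSpace ℝ E]
variable {F : Type*} [NormedAddCommGroup F] [NormedSpace ℝ F]

/-- The derivative of order `k` of the family `u` grows on `K` at most like `ε ^ (a q - N)`, for
some `N` and every mollifier in `A_q`, `q ≥ N`.  The choice `a = 0` describes moderate growth and
the choice `a q = q` negligible growth, so that both can be treated at once. -/
def GrowthAt (a : ℕ → ℤ) (Ω : Domain E) (u : Index → E → ℂ) (K : Set E) (k : ℕ) : Prop :=
  ∃ N : ℕ, ∀ q : ℕ, N ≤ q → ∀ φ : Index, IsMollifier q φ.1 →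
    HasOrder Ω u K k φ (a q - (N : ℤ))

/-- Growth of type `a` for all derivatives and on all compact subsets of the domain. -/
def Growth (a : ℕ → ℤ) (Ω : Domain E) (u : Index → E → ℂ) : Prop :=
  ∀ K ⊆ Ω.carrier, IsCompact K → ∀ k : ℕ, GrowthAt a Ω u K k

/-- The derivative of a family in the direction `e`. -/
def dirDeriv (Ω : Domain E) (e : E) (u : Index → E → ℂ) : Index → E → ℂ :=
  fun φ x => fderivWithin ℝ (u φ) Ω.carrier x e

variable {Ω : Domain E} {u v : Index → E → ℂ} {a : ℕ → ℤ} {K : Set E} {k : ℕ}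

theorem growth_zero_iff : Growth 0 Ω u ↔ IsModerate Ω u := by
  refine ⟨fun h K hK hKc k => ?_, fun h K hK hKc k => ?_⟩
  · obtain ⟨N, hN⟩ := h K hK hKc k
    exact ⟨N, fun φ hφ => by simpa using hN N le_rfl φ hφ⟩
  · obtain ⟨N, hN⟩ := h K hK hKc k
    exact ⟨N, fun q hq φ hφ => by simpa using hN φ (hφ.mono hq)⟩

theorem HasOrder.congr_eventually (hK : K ⊆ Ω.carrier) {φ : Index} {p : ℤ}
    (h : HasOrder Ω u K k φ p)
    (huv : ∀ᶠ ε in 𝓝[>] (0 : ℝ), EqOn (v (φ.scale ε)) (u (φ.scale ε)) Ω.carrier) :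
    HasOrder Ω v K k φ p := by
  obtain ⟨C, hC⟩ := h
  refine ⟨C, ?_⟩
  filter_upwards [hC, huv] with ε h1 h2 x hx
  rw [iteratedFDerivWithin_congr h2 (hK hx)]
  exact h1 x hx

theorem GrowthAt.congr (hK : K ⊆ Ω.carrier) (h : GrowthAt a Ω u K k)
    (huv : ∀ φ : Index, ∀ᶠ ε in 𝓝[>] (0 : ℝ), EqOn (v (φ.scale ε)) (u (φ.scale ε)) Ω.carrier) :
    GrowthAt a Ω v K k := by
  obtain ⟨N, hN⟩ := h
  exact ⟨N, fun q hq φ hφ => (hN q hq φ hφ).congr_eventually hK (huv φ)⟩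

theorem Growth.congr (h : Growth a Ω u)
    (huv : ∀ φ : Index, ∀ᶠ ε in 𝓝[>] (0 : ℝ), EqOn (v (φ.scale ε)) (u (φ.scale ε)) Ω.carrier) :
    Growth a Ω v := fun K hK hKc k => (h K hK hKc k).congr hK huv

theorem Growth.congr' (h : Growth a Ω u) (huv : ∀ φ, EqOn (v φ) (u φ) Ω.carrier) :
    Growth a Ω v := h.congr fun _ => Eventually.of_forall fun _ => huv _

theorem growth_of_eventually_zero
    (h : ∀ φ : Index, ∀ᶠ ε in 𝓝[>] (0 : ℝ), EqOn (u (φ.scale ε)) 0 Ω.carrier) :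
    Growth a Ω u := by
  refine Growth.congr (u := 0) (fun K hK hKc k => ⟨0, fun q hq φ hφ => ⟨0, ?_⟩⟩) h
  exact Eventually.of_forall fun ε x hx => by simp

theorem GrowthAt.add (hu : IsSmooth Ω u) (hv : IsSmooth Ω v) (hK : K ⊆ Ω.carrier)
    (h : GrowthAt a Ω u K k) (h' : GrowthAt a Ω v K k) : GrowthAt a Ω (u + v) K k := by
  obtain ⟨N, hN⟩ := h
  obtain ⟨M, hM⟩ := h'
  exact ⟨N + M, fun q hq φ hφ => HasOrder.add hu hv hK
    ((hN q (by omega) φ hφ).mono (by push_cast; omega))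
    ((hM q (by omega) φ hφ).mono (by push_cast; omega))⟩

theorem Growth.add (hu : IsSmooth Ω u) (hv : IsSmooth Ω v) (h : Growth a Ω u)
    (h' : Growth a Ω v) : Growth a Ω (u + v) :=
  fun K hK hKc k => (h K hK hKc k).add hu hv hK (h' K hK hKc k)

theorem GrowthAt.uniform (h : ∀ i ≤ k, GrowthAt a Ω u K i) :
    ∃ N : ℕ, ∀ q : ℕ, N ≤ q → ∀ φ : Index, IsMollifier q φ.1 → ∀ i ≤ k,
      HasOrder Ω u K i φ (a q - (N : ℤ)) := by
  choose! N hN using h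
  refine ⟨(Finset.range (k + 1)).sup N, fun q hq φ hφ i hi => ?_⟩
  have h1 : N i ≤ (Finset.range (k + 1)).sup N :=
    Finset.le_sup (Finset.mem_range.2 (Nat.lt_succ_iff.2 hi))
  exact (hN i hi q (h1.trans hq) φ hφ).mono (by omega)

/-- The Leibniz rule: moderate families act on every growth class, order by order. -/
theorem GrowthAt.mul (hu : IsSmooth Ω u) (hv : IsSmooth Ω v) (hK : K ⊆ Ω.carrier)
    (h : ∀ i ≤ k, GrowthAt 0 Ω u K i) (h' : ∀ i ≤ k, GrowthAt a Ω v K i) :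
    GrowthAt a Ω (u * v) K k := by
  obtain ⟨N, hN⟩ := GrowthAt.uniform h
  obtain ⟨M, hM⟩ := GrowthAt.uniform h'
  refine ⟨N + M, fun q hq φ hφ => ?_⟩
  refine (HasOrder.mul hu hv hK (hN q (by omega) φ hφ) (hM q (by omega) φ hφ)).mono ?_
  simp only [Pi.zero_apply]
  push_cast
  omega

theorem Growth.mul (hu : IsSmooth Ω u) (hv : IsSmooth Ω v) (h : Growth 0 Ω u)
    (h' : Growth a Ω v) : Growth a Ω (u * v) :=
  fun K hK hKc _ => GrowthAt.mul hu hv hK (fun i _ => h K hK hKc i) (fun i _ => h' K hK hKc i)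

theorem growth_const (c : ℂ) : Growth 0 Ω (fun _ _ => c) :=
  fun _ hK hKc k => ⟨0, fun _ _ φ _ => by
    simpa using HasOrder.of_const (Ω := Ω) (f := fun _ => c) contDiffOn_const hK hKc k φ⟩

theorem isSmooth_const (c : ℂ) : IsSmooth Ω (fun _ _ => c) := fun _ => contDiffOn_const

theorem IsSmooth.add (hu : IsSmooth Ω u) (hv : IsSmooth Ω v) : IsSmooth Ω (u + v) :=
  fun φ => (hu φ).add (hv φ)

theorem IsSmooth.mul (hu : IsSmooth Ω u) (hv : IsSmooth Ω v) : IsSmooth Ω (u * v) :=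
  fun φ => (hu φ).mul (hv φ)

theorem IsSmooth.const_smul (hu : IsSmooth Ω u) (c : ℂ) : IsSmooth Ω (c • u) :=
  fun φ => (contDiffOn_const (c := c)).smul (hu φ)

theorem IsSmooth.dirDeriv (hu : IsSmooth Ω u) (e : E) : IsSmooth Ω (dirDeriv Ω e u) :=
  IsSmooth.deriv hu e

theorem Growth.const_smul (hu : IsSmooth Ω u) (h : Growth a Ω u) (c : ℂ) :
    Growth a Ω (c • u) :=
  (Growth.mul (isSmooth_const c) hu (growth_const c) h).congr' fun _ _ _ => rfl

theorem Growth.sub (hu : IsSmooth Ω u) (hv : IsSmooth Ω v) (h : Growth a Ω u)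
    (h' : Growth a Ω v) : Growth a Ω (u - v) :=
  (h.add hu (hv.const_smul (-1)) (h'.const_smul hv (-1))).congr' fun φ x _ => by
    simp [sub_eq_add_neg]

theorem Growth.dirDeriv (hu : IsSmooth Ω u) (h : Growth a Ω u) (e : E) :
    Growth a Ω (dirDeriv Ω e u) := fun K hK hKc k => by
  obtain ⟨N, hN⟩ := h K hK hKc (k + 1)
  exact ⟨N, fun q hq φ hφ => (hN q hq φ hφ).deriv hu e hK⟩

theorem IsSmooth.pull {Ω' : Domain F} {u : Index → F → ℂ} (hu : IsSmooth Ω' u)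
    (L : E →L[ℝ] F) (hL : MapsTo L Ω.carrier Ω'.carrier) : IsSmooth Ω (fun φ x => u φ (L x)) :=
  fun φ => (hu φ).comp L.contDiff.contDiffOn hL

theorem Growth.pull {Ω' : Domain F} {u : Index → F → ℂ} (hu : IsSmooth Ω' u)
    (h : Growth a Ω' u) (L : E →L[ℝ] F) (hL : MapsTo L Ω.carrier Ω'.carrier) :
    Growth a Ω (fun φ x => u φ (L x)) := fun K hK hKc k => by
  obtain ⟨N, hN⟩ := h (L '' K) (hL.mono_left hK).image_subset (hKc.image L.continuous) k
  exact ⟨N, fun q hq φ hφ => (hN q hq φ hφ).comp hu L hL hK⟩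

/-- The derivatives of order `k + 1` are controlled by the derivatives of order `k` of the first
order derivatives along a basis `e` with dual basis `l`. -/
theorem HasOrder.succ {ι : Type*} [Fintype ι] (e : ι → E) (l : ι → E →L[ℝ] ℝ)
    (hel : ∀ x, x = ∑ i, l i x • e i) (hu : IsSmooth Ω u) (hK : K ⊆ Ω.carrier) {φ : Index}
    {p : ℤ} (h : ∀ i, HasOrder Ω (Colombeau.dirDeriv Ω (e i) u) K k φ p) :
    HasOrder Ω u K (k + 1) φ p := by
  choose C hC0 hC using fun i => (h i).nonneg
  let S : ι → ℂ →L[ℝ] (E →L[ℝ] ℂ) := fun i => (ContinuousLinearMap.smulRightL ℝ E ℂ) (l i)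
  refine ⟨∑ i, ‖S i‖ * C i, ?_⟩
  filter_upwards [eventually_all.2 hC] with ε h1 x hx
  have hx' := hK hx
  set f := u (φ.scale ε) with hf
  have hsm : ∀ i, ContDiffOn ℝ ∞ (fun y => S i (fderivWithin ℝ f Ω.carrier y (e i)))
      Ω.carrier := fun i =>
    (S i).contDiff.comp_contDiffOn (IsSmooth.deriv hu (e i) (φ.scale ε))
  have hsum : ∀ y, fderivWithin ℝ f Ω.carrier y
      = ∑ i, S i (fderivWithin ℝ f Ω.carrier y (e i)) := by
    intro y
    ext w
    conv_lhs => rw [hel w]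
    simp [S, ContinuousLinearMap.smulRightL]
  rw [← norm_iteratedFDerivWithin_fderivWithin Ω.uniqueDiff hx',
    iteratedFDerivWithin_congr (fun y _ => hsum y) hx',
    iteratedFDerivWithin_fun_sum_apply Ω.uniqueDiff hx'
      (fun i _ => ((hsm i).of_le (by exact_mod_cast le_top)) x hx'), Finset.sum_mul]
  refine (norm_sum_le _ _).trans (Finset.sum_le_sum fun i _ => ?_)
  have h2 := (S i).norm_iteratedFDerivWithin_comp_left (n := k) (N := ∞)
    (IsSmooth.deriv hu (e i) (φ.scale ε) x hx') Ω.uniqueDiff hx' (by exact_mod_cast le_top)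
  refine h2.trans ?_
  rw [mul_assoc]
  exact mul_le_mul_of_nonneg_left (h1 i x hx) (norm_nonneg _)

theorem GrowthAt.succ {ι : Type*} [Fintype ι] (e : ι → E) (l : ι → E →L[ℝ] ℝ)
    (hel : ∀ x, x = ∑ i, l i x • e i) (hu : IsSmooth Ω u) (hK : K ⊆ Ω.carrier)
    (h : ∀ i, GrowthAt a Ω (Colombeau.dirDeriv Ω (e i) u) K k) : GrowthAt a Ω u K (k + 1) := by
  choose N hN using h
  refine ⟨∑ i, N i, fun q hq φ hφ => HasOrder.succ e l hel hu hK fun i => ?_⟩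
  have h1 : N i ≤ ∑ i, N i := Finset.single_le_sum (f := N) (fun _ _ => Nat.zero_le _)
    (Finset.mem_univ i)
  exact (hN i q (h1.trans hq) φ hφ).mono (by omega)

theorem GrowthAt.succ_line {Ω : Domain ℝ} {u : Index → ℝ → ℂ} {K : Set ℝ} (hu : IsSmooth Ω u)
    (hK : K ⊆ Ω.carrier) (h : GrowthAt a Ω (Colombeau.dirDeriv Ω 1 u) K k) :
    GrowthAt a Ω u K (k + 1) :=
  GrowthAt.succ (ι := Unit) (fun _ => 1) (fun _ => ContinuousLinearMap.id ℝ ℝ) (by simp) hu hK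
    fun _ => h

theorem GrowthAt.succ_plane {Ω : Domain (ℝ × ℝ)} {u : Index → ℝ × ℝ → ℂ} {K : Set (ℝ × ℝ)}
    (hu : IsSmooth Ω u) (hK : K ⊆ Ω.carrier)
    (h : GrowthAt a Ω (Colombeau.dirDeriv Ω (1, 0) u) K k)
    (h' : GrowthAt a Ω (Colombeau.dirDeriv Ω (0, 1) u) K k) : GrowthAt a Ω u K (k + 1) :=
  GrowthAt.succ (ι := Bool) (fun b => bif b then (1, 0) else (0, 1))
    (fun b => bif b then ContinuousLinearMap.fst ℝ ℝ ℝ else ContinuousLinearMap.snd ℝ ℝ ℝ)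
    (by simp) hu hK (by rintro (_ | _) <;> simpa)

theorem growthAt_zero_iff : GrowthAt a Ω u K 0 ↔
    ∃ N : ℕ, ∀ q : ℕ, N ≤ q → ∀ φ : Index, IsMollifier q φ.1 → ∃ C : ℝ, 0 ≤ C ∧
      ∀ᶠ ε in 𝓝[>] (0 : ℝ), ∀ x ∈ K, ‖u (φ.scale ε) x‖ ≤ C * ε ^ (a q - (N : ℤ)) := by
  refine ⟨fun ⟨N, h⟩ => ⟨N, fun q hq φ hφ => ?_⟩, fun ⟨N, h⟩ => ⟨N, fun q hq φ hφ => ?_⟩⟩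
  · simpa using (h q hq φ hφ).nonneg
  · obtain ⟨C, -, hC⟩ := h q hq φ hφ
    exact ⟨C, by simpa using hC⟩

theorem mk_eq_mk_iff {u v : Moderate Ω} :
    Ideal.Quotient.mk (Negligible Ω) u = Ideal.Quotient.mk (Negligible Ω) v ↔
      Growth (fun q => (q : ℤ)) Ω (u.1 - v.1) := by
  rw [Ideal.Quotient.eq]
  rfl

theorem mem_moderate_iff : u ∈ Moderate Ω ↔ IsSmooth Ω u ∧ Growth 0 Ω u := by
  rw [growth_zero_iff]
  rfl

end Growth

/-! ### Characteristics of a smooth speed -/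

/-- A smooth speed with values between the positive constants `m` and `M`. -/
structure IsSpeed (c : ℝ → ℝ) (m M : ℝ) : Prop where
  smooth : ContDiff ℝ ∞ c
  pos : 0 < m
  lower : ∀ x, m ≤ c x
  upper : ∀ x, c x ≤ M

/-- The time `∫₀ˣ dy / c(y)` needed to travel from `0` to `x` at the speed `c`. -/
def charTime (c : ℝ → ℝ) (x : ℝ) : ℝ := ∫ y in (0 : ℝ)..x, (c y)⁻¹

/-- The inverse function of `charTime c`: the position at time `s` of the characteristic of `c`
that issues from the origin. -/
def charPos (c : ℝ → ℝ) (s : ℝ) : ℝ := Function.invFun (charTime c) s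

@[simp] theorem charTime_zero (c : ℝ → ℝ) : charTime c 0 = 0 := by simp [charTime]

namespace IsSpeed

variable {c : ℝ → ℝ} {m M : ℝ} (h : IsSpeed c m M)
include h

theorem speed_pos (x : ℝ) : 0 < c x := h.pos.trans_le (h.lower x)

theorem upper_pos : 0 < M := (h.speed_pos 0).trans_le (h.upper 0)

theorem contDiff_inv : ContDiff ℝ ∞ fun x => (c x)⁻¹ :=
  h.smooth.inv fun x => (h.speed_pos x).ne'

theorem hasDerivAt_charTime (x : ℝ) : HasDerivAt (charTime c) (c x)⁻¹ x :=
  h.contDiff_inv.continuous.integral_hasStrictDerivAt 0 x |>.hasDerivAt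

theorem contDiff_charTime : ContDiff ℝ ∞ (charTime c) := by
  rw [contDiff_infty_iff_deriv]
  refine ⟨fun x => (h.hasDerivAt_charTime x).differentiableAt, ?_⟩
  have : _root_.deriv (charTime c) = fun x => (c x)⁻¹ :=
    funext fun x => (h.hasDerivAt_charTime x).deriv
  rw [this]
  exact h.contDiff_inv

theorem strictMono_charTime : StrictMono (charTime c) :=
  strictMono_of_hasDerivAt_pos h.hasDerivAt_charTime fun x => inv_pos.2 (h.speed_pos x)

theorem sub_le_charTime {x y : ℝ} (hxy : x ≤ y) :
    M⁻¹ * (y - x) ≤ charTime c y - charTime c x := by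
  refine mul_sub_le_image_sub_of_le_deriv
    (fun x => (h.hasDerivAt_charTime x).differentiableAt) (fun x => ?_) hxy
  rw [(h.hasDerivAt_charTime x).deriv]
  exact inv_anti₀ (h.speed_pos x) (h.upper x)

theorem surjective_charTime : Function.Surjective (charTime c) := by
  have hM := inv_pos.2 h.upper_pos
  refine h.contDiff_charTime.continuous.surjective ?_ ?_
  · refine tendsto_atTop_mono' _ ?_ (tendsto_id.const_mul_atTop hM)
    filter_upwards [eventually_ge_atTop 0] with x hx
    simpa using h.sub_le_charTime hx
  · refine tendsto_atBot_mono' _ ?_ (tendsto_id.const_mul_atBot hM)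
    filter_upwards [eventually_le_atBot 0] with x hx
    have := h.sub_le_charTime hx
    simp only [charTime_zero, id] at *
    linarith

theorem charPos_charTime (x : ℝ) : charPos c (charTime c x) = x :=
  Function.leftInverse_invFun h.strictMono_charTime.injective x

theorem charTime_charPos (s : ℝ) : charTime c (charPos c s) = s :=
  Function.rightInverse_invFun h.surjective_charTime s

theorem charPos_zero : charPos c 0 = 0 := by
  simpa using h.charPos_charTime 0

theorem monotone_charPos : Monotone (charPos c) := fun s t hst => by
  rw [← h.strictMono_charTime.le_iff_le]
  simpa [h.charTime_charPos]

theorem charPos_nonneg {s : ℝ} (hs : 0 ≤ s) : 0 ≤ charPos c s := by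
  simpa [h.charPos_zero] using h.monotone_charPos hs

theorem charPos_nonpos {s : ℝ} (hs : s ≤ 0) : charPos c s ≤ 0 := by
  simpa [h.charPos_zero] using h.monotone_charPos hs

theorem charTime_nonneg {x : ℝ} (hx : 0 ≤ x) : 0 ≤ charTime c x := by
  simpa using h.strictMono_charTime.monotone hx

theorem charPos_sub_le {s t : ℝ} (hst : s ≤ t) : charPos c t - charPos c s ≤ M * (t - s) := by
  have h1 := h.sub_le_charTime (h.monotone_charPos hst)
  rw [h.charTime_charPos, h.charTime_charPos, inv_mul_le_iff₀ h.upper_pos] at h1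
  exact h1

theorem abs_charPos_sub_le (s t : ℝ) : |charPos c t - charPos c s| ≤ M * |t - s| := by
  rcases le_total s t with hst | hst
  · rw [abs_of_nonneg (sub_nonneg.2 (h.monotone_charPos hst)), abs_of_nonneg (sub_nonneg.2 hst)]
    exact h.charPos_sub_le hst
  · rw [abs_sub_comm, abs_sub_comm t, abs_of_nonneg (sub_nonneg.2 (h.monotone_charPos hst)),
      abs_of_nonneg (sub_nonneg.2 hst)]
    exact h.charPos_sub_le hst

/-- The travel time as a homeomorphism of the line, with inverse `charPos c`. -/
def homeo : ℝ ≃ₜ ℝ where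
  toFun := charTime c
  invFun := charPos c
  left_inv := h.charPos_charTime
  right_inv := h.charTime_charPos
  continuous_toFun := h.contDiff_charTime.continuous
  continuous_invFun := by
    have : LipschitzWith (Real.toNNReal M) (charPos c) :=
      LipschitzWith.of_dist_le_mul fun s t => by
        rw [Real.coe_toNNReal _ h.upper_pos.le, Real.dist_eq, Real.dist_eq]
        exact h.abs_charPos_sub_le t s
    exact this.continuous

theorem contDiff_charPos : ContDiff ℝ ∞ (charPos c) :=
  (h.homeo).contDiff_symm_deriv (f' := fun x => (c x)⁻¹)
    (fun x => (inv_pos.2 (h.speed_pos x)).ne') h.hasDerivAt_charTime h.contDiff_charTime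

theorem hasDerivAt_charPos (s : ℝ) : HasDerivAt (charPos c) (c (charPos c s)) s := by
  have h1 := HasDerivAt.of_local_left_inverse (f := charTime c) (g := charPos c) (a := s)
    h.contDiff_charPos.continuous.continuousAt (h.hasDerivAt_charTime (charPos c s))
    (inv_pos.2 (h.speed_pos _)).ne' (Eventually.of_forall h.charTime_charPos)
  simpa using h1

/-- Along the characteristics of `σ c`, a function changes at most by the supremum of
`∂ₜ z + σ c ∂ₓ z` times the elapsed time. -/
theorem norm_sub_le_of_transport {σ : ℝ} {z : ℝ × ℝ → ℂ}
    (hz : DifferentiableOn ℝ z quadrant.carrier) {x t₀ t B : ℝ} (ht₀ : 0 ≤ t₀) (ht : t₀ ≤ t)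
    (hpos : ∀ τ ∈ Icc t₀ t, 0 ≤ charTime c x + σ * (τ - t))
    (hB : ∀ τ ∈ Icc t₀ t, ‖fderivWithin ℝ z quadrant.carrier
        (charPos c (charTime c x + σ * (τ - t)), τ) (0, 1)
      + σ * c (charPos c (charTime c x + σ * (τ - t))) * fderivWithin ℝ z quadrant.carrier
        (charPos c (charTime c x + σ * (τ - t)), τ) (1, 0)‖ ≤ B) :
    ‖z (x, t) - z (charPos c (charTime c x + σ * (t₀ - t)), t₀)‖ ≤ B * (t - t₀) := by
  set g : ℝ → ℝ × ℝ := fun τ => (charPos c (charTime c x + σ * (τ - t)), τ) with hg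
  have hmaps : MapsTo g (Icc t₀ t) quadrant.carrier := fun τ hτ =>
    ⟨h.charPos_nonneg (hpos τ hτ), ht₀.trans hτ.1⟩
  have hgd : ∀ τ, HasDerivAt g (σ * c (g τ).1, 1) τ := fun τ => by
    refine HasDerivAt.prodMk ?_ (hasDerivAt_id τ)
    have h1 : HasDerivAt (fun τ => charTime c x + σ * (τ - t)) (σ * 1) τ :=
      (((hasDerivAt_id τ).sub_const t).const_mul σ).const_add _
    have h2 := (h.hasDerivAt_charPos (charTime c x + σ * (τ - t))).comp τ h1
    simpa [hg, mul_comm, Function.comp_def] using h2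
  have key := norm_image_sub_le_of_norm_deriv_le_segment' (f := z ∘ g) (C := B)
    (f' := fun τ => fderivWithin ℝ z quadrant.carrier (g τ) (σ * c (g τ).1, 1)) (a := t₀) (b := t)
    (fun τ hτ => (hz (g τ) (hmaps hτ)).hasFDerivWithinAt.comp_hasDerivWithinAt τ
      (hgd τ).hasDerivWithinAt hmaps)
    (fun τ hτ => by
      refine le_trans (le_of_eq ?_) (hB τ ⟨hτ.1, hτ.2.le⟩)
      have : ((σ * c (g τ).1, 1) : ℝ × ℝ) = (0, 1) + (σ * c (g τ).1) • (1, 0) := by simp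
      rw [this, map_add, map_smul]
      simp [hg]) t ⟨ht, le_rfl⟩
  simpa [hg, h.charPos_charTime] using key

end IsSpeed

/-! ### Growth estimates for transport equations -/

/-- A moderate family of speeds which are eventually bounded between the constants `m` and `M`
(and vanish identically for the exceptional mollifiers). -/
structure IsSpeedFamily (κ : Index → ℝ → ℝ) (m M : ℝ) : Prop where
  zero_or_speed : ∀ φ, κ φ = 0 ∨ IsSpeed (κ φ) m M
  eventually_speed : ∀ φ : Index, ∀ᶠ ε in 𝓝[>] (0 : ℝ), IsSpeed (κ (φ.scale ε)) m M
  moderate : Growth 0 halfLine (fun φ x => (κ φ x : ℂ))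

/-- A family of functions of `x`, as a family of functions of `(x, t)`. -/
def liftX (c : Index → ℝ → ℂ) : Index → ℝ × ℝ → ℂ := fun φ p => c φ p.1

/-- The vector field `κ ∂ₓ`. -/
def fieldX (κ : Index → ℝ → ℝ) (z : Index → ℝ × ℝ → ℂ) : Index → ℝ × ℝ → ℂ :=
  liftX (fun φ x => (κ φ x : ℂ)) * dirDeriv quadrant (1, 0) z

/-- The transport operator `∂ₜ + σ κ ∂ₓ`. -/
def transportOp (κ : Index → ℝ → ℝ) (σ : ℝ) (z : Index → ℝ × ℝ → ℂ) : Index → ℝ × ℝ → ℂ :=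
  dirDeriv quadrant (0, 1) z + (σ : ℂ) • fieldX κ z

theorem isSmooth_liftX {c : Index → ℝ → ℂ} (hc : IsSmooth halfLine c) :
    IsSmooth quadrant (liftX c) :=
  hc.pull (ContinuousLinearMap.fst ℝ ℝ ℝ) (fun _ hp => hp.1)

theorem growth_liftX {a : ℕ → ℤ} {c : Index → ℝ → ℂ} (hc : IsSmooth halfLine c)
    (h : Growth a halfLine c) : Growth a quadrant (liftX c) :=
  h.pull hc (ContinuousLinearMap.fst ℝ ℝ ℝ) (fun _ hp => hp.1)

theorem mem_closure_interior_quadrant {p : ℝ × ℝ} (hp : p ∈ quadrant.carrier) :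
    p ∈ closure (interior quadrant.carrier) := by
  change p ∈ closure (interior (Ici 0 ×ˢ Ici 0))
  rw [interior_prod_eq, interior_Ici, closure_prod_eq, closure_Ioi]
  exact hp

theorem fderivWithin_fderivWithin_comm {f : ℝ × ℝ → ℂ} (hf : ContDiffOn ℝ ∞ f quadrant.carrier)
    {p : ℝ × ℝ} (hp : p ∈ quadrant.carrier) (v w : ℝ × ℝ) :
    fderivWithin ℝ (fun y => fderivWithin ℝ f quadrant.carrier y v) quadrant.carrier p w
      = fderivWithin ℝ (fun y => fderivWithin ℝ f quadrant.carrier y w) quadrant.carrier p v := by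
  have hd : DifferentiableWithinAt ℝ (fderivWithin ℝ f quadrant.carrier) quadrant.carrier p :=
    ((contDiffOn_infty_iff_fderivWithin quadrant.uniqueDiff).1 hf).2.differentiableOn
      (by simp) p hp
  have hu := quadrant.uniqueDiff p hp
  have hs : IsSymmSndFDerivWithinAt ℝ f quadrant.carrier p :=
    (hf p hp).isSymmSndFDerivWithinAt (by
      simp only [minSmoothness_of_isRCLikeNormedField]
      exact ENat.LEInfty.out)
      quadrant.uniqueDiff (mem_closure_interior_quadrant hp) hp
  rw [fderivWithin_clm_apply hu hd (differentiableWithinAt_const v),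
    fderivWithin_clm_apply hu hd (differentiableWithinAt_const w)]
  simpa using hs w v

theorem dirDeriv_initial {z : Index → ℝ × ℝ → ℂ} (hz : IsSmooth quadrant z) (φ : Index) {x : ℝ}
    (hx : 0 ≤ x) : dirDeriv halfLine 1 (fun φ x => z φ (x, 0)) φ x
      = dirDeriv quadrant (1, 0) z φ (x, 0) := by
  have h1 : HasFDerivWithinAt (z φ) _ quadrant.carrier (ContinuousLinearMap.inl ℝ ℝ ℝ x) :=
    ((hz φ).differentiableOn (by simp) (x, 0) ⟨hx, le_refl (0 : ℝ)⟩).hasFDerivWithinAt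
  have h2 := h1.comp x (ContinuousLinearMap.inl ℝ ℝ ℝ).hasFDerivWithinAt
    (s := halfLine.carrier) (fun _ hy => ⟨hy, le_refl (0 : ℝ)⟩)
  have h3 := h2.fderivWithin (halfLine.uniqueDiff x hx)
  have h4 := congrArg (fun L : ℝ →L[ℝ] ℂ => L 1) h3
  exact h4

theorem dirDeriv_boundary {z : Index → ℝ × ℝ → ℂ} (hz : IsSmooth quadrant z) (φ : Index) {t : ℝ}
    (ht : 0 ≤ t) : dirDeriv halfLine 1 (fun φ t => z φ (0, t)) φ t
      = dirDeriv quadrant (0, 1) z φ (0, t) := by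
  have h1 : HasFDerivWithinAt (z φ) _ quadrant.carrier (ContinuousLinearMap.inr ℝ ℝ ℝ t) :=
    ((hz φ).differentiableOn (by simp) (0, t) ⟨le_refl (0 : ℝ), ht⟩).hasFDerivWithinAt
  have h2 := h1.comp t (ContinuousLinearMap.inr ℝ ℝ ℝ).hasFDerivWithinAt
    (s := halfLine.carrier) (fun _ hy => ⟨le_refl (0 : ℝ), hy⟩)
  have h3 := h2.fderivWithin (halfLine.uniqueDiff t ht)
  have h4 := congrArg (fun L : ℝ →L[ℝ] ℂ => L 1) h3
  exact h4

theorem isSmooth_initial {z : Index → ℝ × ℝ → ℂ} (hz : IsSmooth quadrant z) :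
    IsSmooth halfLine fun φ x => z φ (x, 0) :=
  hz.pull (ContinuousLinearMap.inl ℝ ℝ ℝ) fun _ hx => ⟨hx, le_refl (0 : ℝ)⟩

theorem isSmooth_boundary {z : Index → ℝ × ℝ → ℂ} (hz : IsSmooth quadrant z) :
    IsSmooth halfLine fun φ t => z φ (0, t) :=
  hz.pull (ContinuousLinearMap.inr ℝ ℝ ℝ) fun _ hx => ⟨le_refl (0 : ℝ), hx⟩

theorem exists_subset_square {K : Set (ℝ × ℝ)} (hK : K ⊆ quadrant.carrier) (hKc : IsCompact K) :
    ∃ R : ℝ, 0 ≤ R ∧ ∀ p ∈ K, p.1 ∈ Icc 0 R ∧ p.2 ∈ Icc 0 R := by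
  obtain ⟨R, hR⟩ := hKc.isBounded.exists_norm_le
  refine ⟨max R 0, le_max_right _ _, fun p hp => ?_⟩
  have h1 := (norm_prod_le_iff.1 (hR p hp))
  exact ⟨⟨(hK hp).1, (le_abs_self _).trans (h1.1.trans (le_max_left _ _))⟩,
    ⟨(hK hp).2, (le_abs_self _).trans (h1.2.trans (le_max_left _ _))⟩⟩

namespace IsSpeedFamily

variable {κ : Index → ℝ → ℝ} {m M : ℝ} (h : IsSpeedFamily κ m M)
include h

theorem contDiff (φ : Index) : ContDiff ℝ ∞ fun x => (κ φ x : ℂ) := by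
  rcases h.zero_or_speed φ with h0 | h0
  · simpa [h0] using contDiff_const
  · exact Complex.ofRealCLM.contDiff.comp h0.smooth

theorem isSmooth : IsSmooth halfLine (fun φ x => (κ φ x : ℂ)) := fun φ => (h.contDiff φ).contDiffOn

theorem isSmooth_inv : IsSmooth halfLine (fun φ x => (κ φ x : ℂ)⁻¹) := fun φ => by
  rcases h.zero_or_speed φ with h0 | h0
  · simpa [h0] using contDiffOn_const
  · exact ((h.contDiff φ).inv fun x => by exact_mod_cast (h0.speed_pos x).ne').contDiffOn

/-- The inverse of the speed is moderate, because `(1 / κ)' = - κ' (1 / κ)²`. -/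
theorem growth_inv : Growth 0 halfLine (fun φ x => (κ φ x : ℂ)⁻¹) := by
  intro K hK hKc k
  induction k using Nat.strong_induction_on with
  | _ k ih =>
  rcases k with _ | k
  · rw [growthAt_zero_iff]
    refine ⟨0, fun q _ φ _ => ?_⟩
    obtain ⟨ε₀, hm⟩ := (h.eventually_speed φ).exists
    refine ⟨m⁻¹, inv_nonneg.2 hm.pos.le, ?_⟩
    filter_upwards [h.eventually_speed φ] with ε hε x _
    rw [norm_inv, Complex.norm_real, Real.norm_of_nonneg (hε.speed_pos x).le]
    simpa using inv_anti₀ hε.pos (hε.lower x)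
  · refine GrowthAt.succ_line h.isSmooth_inv hK ?_
    have hd := (h.moderate.dirDeriv h.isSmooth 1).const_smul (h.isSmooth.dirDeriv 1) (-1)
    have hds := (h.isSmooth.dirDeriv 1).const_smul (-1)
    have hww : ∀ i ≤ k, GrowthAt 0 halfLine
        ((fun φ x => (κ φ x : ℂ)⁻¹) * (fun φ x => (κ φ x : ℂ)⁻¹)) K i := fun i hi =>
      GrowthAt.mul h.isSmooth_inv h.isSmooth_inv hK (fun j hj => ih j (by omega))
        (fun j hj => ih j (by omega))
    refine (GrowthAt.mul hds (h.isSmooth_inv.mul h.isSmooth_inv) hK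
      (fun i _ => hd K hK hKc i) hww).congr hK fun φ => ?_
    filter_upwards [h.eventually_speed φ] with ε hε x hx
    have hne : (κ (φ.scale ε) x : ℂ) ≠ 0 := by exact_mod_cast (hε.speed_pos x).ne'
    have hu := halfLine.uniqueDiff x hx
    have hdx : DifferentiableAt ℝ (fun x => (κ (φ.scale ε) x : ℂ)) x :=
      (h.contDiff (φ.scale ε)).differentiable (by simp) x
    have h1 := (hdx.hasDerivAt.inv hne).hasFDerivAt.hasFDerivWithinAt (s := halfLine.carrier)
    have h2 := hdx.hasDerivAt.hasFDerivAt.hasFDerivWithinAt (s := halfLine.carrier)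
    simp only [Colombeau.dirDeriv, Pi.mul_apply, Pi.smul_apply]
    have h3 := h1.fderivWithin hu
    have h4 := h2.fderivWithin hu
    change fderivWithin ℝ (fun x => (κ (φ.scale ε) x : ℂ))⁻¹ halfLine.carrier x 1 = _
    rw [h3, h4]
    simp
    field_simp

theorem isSmooth_liftX_speed : IsSmooth quadrant (liftX fun φ x => (κ φ x : ℂ)) :=
  isSmooth_liftX h.isSmooth

theorem isSmooth_fieldX {z : Index → ℝ × ℝ → ℂ} (hz : IsSmooth quadrant z) :
    IsSmooth quadrant (fieldX κ z) := h.isSmooth_liftX_speed.mul (hz.dirDeriv _)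

theorem isSmooth_transportOp {z : Index → ℝ × ℝ → ℂ} (hz : IsSmooth quadrant z) (σ : ℝ) :
    IsSmooth quadrant (transportOp κ σ z) :=
  (hz.dirDeriv _).add ((h.isSmooth_fieldX hz).const_smul _)

theorem growth_fieldX {a : ℕ → ℤ} {z : Index → ℝ × ℝ → ℂ} (hz : IsSmooth quadrant z)
    (hg : Growth a quadrant z) : Growth a quadrant (fieldX κ z) :=
  Growth.mul h.isSmooth_liftX_speed (hz.dirDeriv _) (growth_liftX h.isSmooth h.moderate)
    (hg.dirDeriv hz _)

/-- The vector field `κ ∂ₓ` commutes with `∂ₜ + σ κ ∂ₓ`, since `κ` does not depend on `t`. -/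
theorem transportOp_fieldX {z : Index → ℝ × ℝ → ℂ} (hz : IsSmooth quadrant z) (σ : ℝ) (φ : Index) :
    EqOn (transportOp κ σ (fieldX κ z) φ) (fieldX κ (transportOp κ σ z) φ) quadrant.carrier := by
  intro p hp
  have hu := quadrant.uniqueDiff p hp
  have hcx : DifferentiableWithinAt ℝ (fun y : ℝ × ℝ => (κ φ y.1 : ℂ)) quadrant.carrier p :=
    (h.isSmooth_liftX_speed φ).differentiableOn (by simp) p hp
  have hX : DifferentiableWithinAt ℝ (fieldX κ z φ) quadrant.carrier p :=
    (h.isSmooth_fieldX hz φ).differentiableOn (by simp) p hp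
  have hzx : DifferentiableWithinAt ℝ (fun y => fderivWithin ℝ (z φ) quadrant.carrier y (1, 0))
      quadrant.carrier p := (hz.dirDeriv (1, 0) φ).differentiableOn (by simp) p hp
  have hzt : DifferentiableWithinAt ℝ (fun y => fderivWithin ℝ (z φ) quadrant.carrier y (0, 1))
      quadrant.carrier p := (hz.dirDeriv (0, 1) φ).differentiableOn (by simp) p hp
  -- The speed does not depend on `t`.
  have hct : fderivWithin ℝ (fun y : ℝ × ℝ => (κ φ y.1 : ℂ)) quadrant.carrier p (0, 1) = 0 := by
    have h1 : HasFDerivAt (fun x => (κ φ x : ℂ)) (fderiv ℝ (fun x => (κ φ x : ℂ)) p.1) p.1 :=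
      ((h.contDiff φ).differentiable (by simp) p.1).hasFDerivAt
    have h2 := (h1.comp p (hasFDerivAt_fst (𝕜 := ℝ))).hasFDerivWithinAt (s := quadrant.carrier)
    have h3 := h2.fderivWithin hu
    simp only [Function.comp_def] at h3
    rw [h3]
    simp
  have e1 : fderivWithin ℝ (fieldX κ z φ) quadrant.carrier p (0, 1)
      = κ φ p.1 * fderivWithin ℝ (fun y => fderivWithin ℝ (z φ) quadrant.carrier y (0, 1))
          quadrant.carrier p (1, 0) := by
    have h1 : fieldX κ z φ = (fun y : ℝ × ℝ => (κ φ y.1 : ℂ))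
      * (fun y => fderivWithin ℝ (z φ) quadrant.carrier y (1, 0)) := rfl
    rw [h1, fderivWithin_mul hu hcx hzx]
    simp [hct, fderivWithin_fderivWithin_comm (hz φ) hp (1, 0) (0, 1)]
  have e2 : fderivWithin ℝ (transportOp κ σ z φ) quadrant.carrier p (1, 0)
      = fderivWithin ℝ (fun y => fderivWithin ℝ (z φ) quadrant.carrier y (0, 1))
          quadrant.carrier p (1, 0)
        + σ * fderivWithin ℝ (fieldX κ z φ) quadrant.carrier p (1, 0) := by
    have h1 : transportOp κ σ z φ = (fun y => fderivWithin ℝ (z φ) quadrant.carrier y (0, 1))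
      + (σ : ℂ) • fieldX κ z φ := rfl
    rw [h1, fderivWithin_add hu hzt (hX.const_smul _), fderivWithin_const_smul hu hX]
    simp
  change fderivWithin ℝ (fieldX κ z φ) quadrant.carrier p (0, 1)
      + σ * (κ φ p.1 * fderivWithin ℝ (fieldX κ z φ) quadrant.carrier p (1, 0))
    = κ φ p.1 * fderivWithin ℝ (transportOp κ σ z φ) quadrant.carrier p (1, 0)
  rw [e1, e2]
  ring

/-- If a class of families is stable under `κ ∂ₓ`, and in this class `∂ₜ z + σ κ ∂ₓ z` has growth
of type `a` and `z` satisfies the corresponding estimates of order zero, then all derivatives of `z`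
satisfy them: the derivatives are recovered from `κ ∂ₓ z` since `1 / κ` is moderate. -/
theorem growth_of_stable {a : ℕ → ℤ} {σ : ℝ} {Q : (Index → ℝ × ℝ → ℂ) → Prop}
    (hsm : ∀ z, Q z → IsSmooth quadrant z)
    (h0 : ∀ z, Q z → ∀ K ⊆ quadrant.carrier, IsCompact K → GrowthAt a quadrant z K 0)
    (hX : ∀ z, Q z → Q (fieldX κ z)) (hL : ∀ z, Q z → Growth a quadrant (transportOp κ σ z))
    {z : Index → ℝ × ℝ → ℂ} (hz : Q z) : Growth a quadrant z := by
  intro K hK hKc k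
  induction k using Nat.strong_induction_on generalizing z with
  | _ k ih =>
  rcases k with _ | k
  · exact h0 z hz K hK hKc
  · have hXs := hsm _ (hX z hz)
    refine GrowthAt.succ_plane (hsm z hz) hK ?_ ?_
    · refine (GrowthAt.mul (isSmooth_liftX h.isSmooth_inv) hXs hK
        (fun i _ => growth_liftX h.isSmooth_inv h.growth_inv K hK hKc i)
        (fun i hi => ih i (by omega) (hX z hz))).congr hK fun φ => ?_
      filter_upwards [h.eventually_speed φ] with ε hε p _
      have hne : (κ (φ.scale ε) p.1 : ℂ) ≠ 0 := by exact_mod_cast (hε.speed_pos p.1).ne'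
      simp [liftX, fieldX, hne]
    · refine (GrowthAt.add (h.isSmooth_transportOp (hsm z hz) σ)
        (hXs.const_smul (-(σ : ℂ))) hK (hL z hz K hK hKc k) (u := transportOp κ σ z) ?_).congr hK
        fun φ => Eventually.of_forall fun ε p _ => ?_
      · exact (GrowthAt.mul (isSmooth_const (-(σ : ℂ))) hXs hK
          (fun i _ => growth_const _ K hK hKc i) (fun i hi => ih i (by omega) (hX z hz))).congr hK
          fun φ => Eventually.of_forall fun ε p _ => rfl
      · simp [transportOp]

theorem growth_initial_fieldX {a : ℕ → ℤ} {z : Index → ℝ × ℝ → ℂ} (hz : IsSmooth quadrant z)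
    (hg : Growth a halfLine fun φ x => z φ (x, 0)) :
    Growth a halfLine fun φ x => fieldX κ z φ (x, 0) := by
  have hs := isSmooth_initial hz
  refine (Growth.mul h.isSmooth (hs.dirDeriv 1) h.moderate (hg.dirDeriv hs 1)).congr'
    fun φ x hx => ?_
  simp only [Pi.mul_apply, dirDeriv_initial hz φ hx]
  rfl

/-- On the axis `x = 0` the spatial derivative is not a derivative of the boundary values; it is
recovered from the equation and the time derivative. -/
theorem growth_boundary_fieldX {a : ℕ → ℤ} {z : Index → ℝ × ℝ → ℂ} (hz : IsSmooth quadrant z)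
    (hL : Growth a quadrant (transportOp κ 1 z)) (hg : Growth a halfLine fun φ t => z φ (0, t)) :
    Growth a halfLine fun φ t => fieldX κ z φ (0, t) := by
  have hs := isSmooth_boundary hz
  have hLs := h.isSmooth_transportOp hz 1
  refine (Growth.sub (isSmooth_boundary hLs) (hs.dirDeriv 1)
    (hL.pull hLs (ContinuousLinearMap.inr ℝ ℝ ℝ) fun _ hx => ⟨le_refl (0 : ℝ), hx⟩)
    (hg.dirDeriv hs 1)).congr' fun φ t ht => ?_
  simp only [Pi.sub_apply, dirDeriv_boundary hz φ ht]
  simp [transportOp]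

end IsSpeedFamily

/-- Characteristics starting in `[0, R] × [0, R]` stay in `[0, R + M R] × [0, R]`. -/
theorem IsSpeed.norm_sub_le_of_square {c : ℝ → ℝ} {m M : ℝ} (h : IsSpeed c m M) {σ : ℝ}
    (hσ : |σ| = 1) {z : ℝ × ℝ → ℂ} (hz : ContDiffOn ℝ ∞ z quadrant.carrier) {R x t₀ t B : ℝ}
    (hx : x ∈ Icc 0 R) (ht : t ∈ Icc 0 R) (ht₀ : t₀ ∈ Icc 0 t) (hB0 : 0 ≤ B)
    (hpos : ∀ τ ∈ Icc t₀ t, 0 ≤ charTime c x + σ * (τ - t))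
    (hB : ∀ p ∈ Icc 0 (R + M * R) ×ˢ Icc 0 R, ‖fderivWithin ℝ z quadrant.carrier p (0, 1)
      + σ * (c p.1 * fderivWithin ℝ z quadrant.carrier p (1, 0))‖ ≤ B) :
    ‖z (x, t)‖ ≤ ‖z (charPos c (charTime c x + σ * (t₀ - t)), t₀)‖ + B * R ∧
      charPos c (charTime c x + σ * (t₀ - t)) ∈ Icc 0 (R + M * R) := by
  have hM := h.upper_pos.le
  have hmem : ∀ τ ∈ Icc t₀ t, charPos c (charTime c x + σ * (τ - t)) ∈ Icc 0 (R + M * R) := by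
    intro τ hτ
    refine ⟨h.charPos_nonneg (hpos τ hτ), ?_⟩
    have h1 := h.abs_charPos_sub_le (charTime c x) (charTime c x + σ * (τ - t))
    rw [add_sub_cancel_left, abs_mul, hσ, one_mul, h.charPos_charTime] at h1
    have h2 : |τ - t| ≤ R := by
      rw [abs_le]
      constructor <;> linarith [hτ.1, hτ.2, ht.1, ht.2, ht₀.1]
    have h3 := (le_abs_self _).trans (h1.trans (mul_le_mul_of_nonneg_left h2 hM))
    linarith [hx.2]
  refine ⟨?_, hmem t₀ ⟨le_rfl, ht₀.2⟩⟩
  have h1 := h.norm_sub_le_of_transport (hz.differentiableOn (by simp)) ht₀.1 ht₀.2 hpos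
    (fun τ hτ => by
      rw [mul_assoc]
      exact hB _ ⟨hmem τ hτ, ht₀.1.trans hτ.1, hτ.2.trans ht.2⟩)
  have h2 : B * (t - t₀) ≤ B * R := mul_le_mul_of_nonneg_left (by linarith [ht.2, ht₀.1]) hB0
  have h3 := norm_le_norm_add_norm_sub' (z (x, t)) (z (charPos c (charTime c x + σ * (t₀ - t)), t₀))
  linarith

namespace IsSpeedFamily

variable {κ : Index → ℝ → ℝ} {m M : ℝ} (h : IsSpeedFamily κ m M)
include h

/-- The values of `z` have the growth of `∂ₜ z + σ κ ∂ₓ z`, of the initial values and of a family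
`g` which dominates `z` wherever a characteristic does not arrive at `t = 0`. -/
theorem growthAt_zero_of_transport {a : ℕ → ℤ} {σ : ℝ} (hσ : |σ| = 1) {z : Index → ℝ × ℝ → ℂ}
    (hz : IsSmooth quadrant z) (hL : Growth a quadrant (transportOp κ σ z))
    (hi : Growth a halfLine fun φ x => z φ (x, 0))
    {g : Index → ℝ → ℂ} (hg : Growth a halfLine g)
    (hend : ∀ φ, IsSpeed (κ φ) m M → ∀ x t, 0 ≤ x → 0 ≤ t → ∃ t₀ ∈ Icc 0 t,
      (∀ τ ∈ Icc t₀ t, 0 ≤ charTime (κ φ) x + σ * (τ - t)) ∧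
      (t₀ = 0 ∨ ‖z φ (charPos (κ φ) (charTime (κ φ) x + σ * (t₀ - t)), t₀)‖ ≤ ‖g φ t₀‖))
    {K : Set (ℝ × ℝ)} (hK : K ⊆ quadrant.carrier) (hKc : IsCompact K) :
    GrowthAt a quadrant z K 0 := by
  obtain ⟨R, hR0, hR⟩ := exists_subset_square hK hKc
  obtain ⟨N, hN⟩ := growthAt_zero_iff.1 (hL (Icc 0 (R + M * R) ×ˢ Icc 0 R)
    (fun p hp => ⟨hp.1.1, hp.2.1⟩) (isCompact_Icc.prod isCompact_Icc) 0)
  obtain ⟨N', hN'⟩ := growthAt_zero_iff.1 (hg (Icc 0 (R + M * R)) (fun p hp => hp.1)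
    isCompact_Icc 0)
  obtain ⟨N₀, hN₀⟩ := growthAt_zero_iff.1 (hi (Icc 0 (R + M * R)) (fun p hp => hp.1)
    isCompact_Icc 0)
  rw [growthAt_zero_iff]
  refine ⟨N + N' + N₀, fun q hq φ hφ => ?_⟩
  obtain ⟨B, hB0, hB⟩ := hN q (by omega) φ hφ
  obtain ⟨C, hC0, hC⟩ := hN' q (by omega) φ hφ
  obtain ⟨A, hA0, hA⟩ := hN₀ q (by omega) φ hφ
  refine ⟨A + C + B * R, by positivity, ?_⟩
  have hε1 : ∀ᶠ ε in 𝓝[>] (0 : ℝ), ε < 1 :=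
    (eventually_lt_nhds zero_lt_one).filter_mono nhdsWithin_le_nhds
  filter_upwards [hB, hC, hA, h.eventually_speed φ, hε1, self_mem_nhdsWithin]
    with ε h1 h2 h0 h3 h4 (h5 : 0 < ε) p hp
  obtain ⟨hx, ht⟩ := hR p hp
  obtain ⟨t₀, ht₀, hpos, hor⟩ := hend _ h3 p.1 p.2 hx.1 ht.1
  obtain ⟨e1, e2⟩ := h3.norm_sub_le_of_square hσ (hz (φ.scale ε)) hx ht ht₀
    (B := B * ε ^ (a q - (N : ℤ))) (by positivity) hpos h1
  have hM := h3.upper_pos.le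
  have hmono : ∀ n ≤ N + N' + N₀,
      ε ^ (a q - (n : ℤ)) ≤ ε ^ (a q - ((N + N' + N₀ : ℕ) : ℤ)) := fun n hn =>
    zpow_le_zpow_right_of_le_one₀ h5 h4.le (by omega)
  have e3 : ‖z (φ.scale ε) (charPos (κ (φ.scale ε)) (charTime (κ (φ.scale ε)) p.1
      + σ * (t₀ - p.2)), t₀)‖ ≤ (A + C) * ε ^ (a q - ((N + N' + N₀ : ℕ) : ℤ)) := by
    have hp0 : 0 ≤ ε ^ (a q - ((N + N' + N₀ : ℕ) : ℤ)) := by positivity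
    rcases hor with rfl | hor
    · refine (h0 _ e2).trans ?_
      have := mul_le_mul_of_nonneg_left (hmono N₀ (by omega)) hA0
      nlinarith
    · refine hor.trans ((h2 _ ⟨ht₀.1, ?_⟩).trans ?_)
      · have : 0 ≤ M * R := by positivity
        linarith [ht₀.2, ht.2]
      · have := mul_le_mul_of_nonneg_left (hmono N' (by omega)) hC0
        nlinarith
  have e4 := mul_le_mul_of_nonneg_right
    (mul_le_mul_of_nonneg_left (hmono N (by omega)) hB0) hR0
  linarith

/-- A family transported to the left is controlled by its right-hand side and its initial values. -/
theorem growth_of_leftward {a : ℕ → ℤ} {z : Index → ℝ × ℝ → ℂ} (hz : IsSmooth quadrant z)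
    (hL : Growth a quadrant (transportOp κ (-1) z))
    (hg : Growth a halfLine fun φ x => z φ (x, 0)) : Growth a quadrant z := by
  refine h.growth_of_stable (σ := -1) (Q := fun z => IsSmooth quadrant z ∧
    Growth a quadrant (transportOp κ (-1) z) ∧ Growth a halfLine fun φ x => z φ (x, 0))
    (fun z hz => hz.1) (fun z hz K hK hKc => ?_) (fun z hz => ⟨h.isSmooth_fieldX hz.1,
      (h.growth_fieldX (h.isSmooth_transportOp hz.1 _) hz.2.1).congr'
        (h.transportOp_fieldX hz.1 _), h.growth_initial_fieldX hz.1 hz.2.2⟩)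
    (fun z hz => hz.2.1) ⟨hz, hL, hg⟩
  refine h.growthAt_zero_of_transport (by simp) hz.1 hz.2.1 hz.2.2 (g := 0)
    (growth_of_eventually_zero fun φ => Eventually.of_forall fun ε => eqOn_refl _ _)
    (fun φ hφ x t hx ht => ?_) hK hKc
  refine ⟨0, ⟨le_rfl, ht⟩, fun τ hτ => ?_, Or.inl rfl⟩
  linarith [hφ.charTime_nonneg hx, hτ.2]

/-- A family transported to the right is controlled by its right-hand side, its initial values and
its boundary values. -/
theorem growth_of_rightward {a : ℕ → ℤ} {z : Index → ℝ × ℝ → ℂ} (hz : IsSmooth quadrant z)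
    (hL : Growth a quadrant (transportOp κ 1 z))
    (hg : Growth a halfLine fun φ x => z φ (x, 0))
    (hb : Growth a halfLine fun φ t => z φ (0, t)) : Growth a quadrant z := by
  refine h.growth_of_stable (σ := 1) (Q := fun z => IsSmooth quadrant z ∧
    Growth a quadrant (transportOp κ 1 z) ∧ (Growth a halfLine fun φ x => z φ (x, 0)) ∧
      Growth a halfLine fun φ t => z φ (0, t))
    (fun z hz => hz.1) (fun z hz K hK hKc => ?_) (fun z hz => ⟨h.isSmooth_fieldX hz.1,
      (h.growth_fieldX (h.isSmooth_transportOp hz.1 _) hz.2.1).congr'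
        (h.transportOp_fieldX hz.1 _), h.growth_initial_fieldX hz.1 hz.2.2.1,
          h.growth_boundary_fieldX hz.1 hz.2.1 hz.2.2.2⟩)
    (fun z hz => hz.2.1) ⟨hz, hL, hg, hb⟩
  refine h.growthAt_zero_of_transport (by simp) hz.1 hz.2.1 hz.2.2.1 hz.2.2.2
    (fun φ hφ x t hx ht => ?_) hK hKc
  have hT := hφ.charTime_nonneg hx
  rcases le_total t (charTime (κ φ) x) with h1 | h1
  · exact ⟨0, ⟨le_rfl, ht⟩, fun τ hτ => by linarith [hτ.1], Or.inl rfl⟩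
  · refine ⟨t - charTime (κ φ) x, ⟨by linarith, by linarith⟩, fun τ hτ => by linarith [hτ.1],
      Or.inr (le_of_eq ?_)⟩
    have : charTime (κ φ) x + 1 * (t - charTime (κ φ) x - t) = 0 := by ring
    rw [this, hφ.charPos_zero]

end IsSpeedFamily

/-! ### Convolution of a bounded function with a dilated test function -/

theorem contDiff_dilate {g : ℝ → ℂ} (hg : ContDiff ℝ ∞ g) (η : ℝ) : ContDiff ℝ ∞ (dilate η g) :=
  contDiff_const.mul (hg.comp (contDiff_id.div_const η))

theorem hasCompactSupport_dilate {g : ℝ → ℂ} (hg : HasCompactSupport g) (η : ℝ) :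
    HasCompactSupport (dilate η g) := by
  rcases eq_or_ne η 0 with rfl | hη
  · have : dilate 0 g = 0 := by ext x; simp [dilate]
    rw [this]
    exact HasCompactSupport.zero
  · have h1 : HasCompactSupport (fun x : ℝ => g (x / η)) := by
      have := hg.comp_homeomorph (Homeomorph.mulRight₀ η⁻¹ (inv_ne_zero hη))
      simpa [Function.comp_def, div_eq_mul_inv] using this
    exact h1.mul_left

theorem deriv_dilate {g : ℝ → ℂ} (hg : ContDiff ℝ ∞ g) (η : ℝ) :
    _root_.deriv (dilate η g) = (η : ℂ)⁻¹ • dilate η (_root_.deriv g) := by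
  ext x
  have h1 : HasDerivAt g (_root_.deriv g (x / η)) (x / η) :=
    (hg.differentiable (by simp) _).hasDerivAt
  have h2 := (h1.scomp x ((hasDerivAt_id x).div_const η)).const_mul (η : ℂ)⁻¹
  have h3 : HasDerivAt (dilate η g) _ x := h2
  rw [h3.deriv]
  simp only [dilate, Pi.smul_apply, smul_eq_mul, Complex.real_smul, Complex.ofReal_div,
    Complex.ofReal_one]
  ring

theorem locallyIntegrable_of_bounded {f : ℝ → ℂ} (hf : AEStronglyMeasurable f) {B : ℝ}
    (hB : ∀ x, ‖f x‖ ≤ B) : LocallyIntegrable f := by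
  have h : LocallyIntegrable (fun _ : ℝ => B) := locallyIntegrable_const B
  exact h.mono hf (Eventually.of_forall fun x => (hB x).trans (le_abs_self B))

theorem norm_convolution_le {f k : ℝ → ℂ} {B : ℝ} (hB : ∀ x, ‖f x‖ ≤ B) (hk : Integrable k)
    (x : ℝ) : ‖(f ⋆[ContinuousLinearMap.mul ℝ ℂ, volume] k) x‖ ≤ B * ∫ y, ‖k y‖ := by
  rw [convolution_eq_swap, ← integral_const_mul]
  refine norm_integral_le_of_norm_le (hk.norm.const_mul B) (Eventually.of_forall fun t => ?_)
  rw [ContinuousLinearMap.mul_apply', norm_mul]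
  exact mul_le_mul_of_nonneg_right (hB _) (norm_nonneg _)

theorem convolution_dilate (f g : ℝ → ℂ) {η : ℝ} (hη : 0 < η) (x : ℝ) :
    (f ⋆[ContinuousLinearMap.mul ℝ ℂ, volume] dilate η g) x = ∫ y, f (x - η * y) * g y := by
  have h := Measure.integral_comp_div (fun y => f (x - η * y) * g y) η
  have hne : (η : ℂ) ≠ 0 := by exact_mod_cast hη.ne'
  rw [abs_of_pos hη, ← inv_smul_eq_iff₀ hη.ne'] at h
  rw [convolution_eq_swap, ← h, ← integral_smul]
  refine integral_congr_ae (Eventually.of_forall fun t => ?_)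
  have : η * (t / η) = t := mul_div_cancel₀ t hη.ne'
  simp only [ContinuousLinearMap.mul_apply', dilate, this, Complex.real_smul, Complex.ofReal_inv]
  ring

theorem integral_norm_dilate (g : ℝ → ℂ) {η : ℝ} (hη : 0 < η) :
    ∫ y, ‖dilate η g y‖ = ∫ y, ‖g y‖ := by
  have h := Measure.integral_comp_div (fun y => ‖g y‖) η
  rw [abs_of_pos hη, ← inv_smul_eq_iff₀ hη.ne'] at h
  rw [← h, ← integral_smul]
  simp [dilate, abs_of_pos hη]

theorem contDiff_convolution {f k : ℝ → ℂ} (hf : AEStronglyMeasurable f) {B : ℝ}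
    (hB : ∀ x, ‖f x‖ ≤ B) (hk : ContDiff ℝ ∞ k) (hkc : HasCompactSupport k) :
    ContDiff ℝ ∞ (f ⋆[ContinuousLinearMap.mul ℝ ℂ, volume] k) :=
  hkc.contDiff_convolution_right _ (locallyIntegrable_of_bounded hf hB) hk

/-- At a point of continuity `y` of the bounded function `f`, the regularizations `f * g_η` converge
to `f y`, even along points that vary with `η`. -/
theorem tendsto_convolution_dilate {ι : Type*} {l : Filter ι} [l.IsCountablyGenerated]
    {f g : ℝ → ℂ} (hf : AEStronglyMeasurable f) {B : ℝ} (hB : ∀ x, ‖f x‖ ≤ B)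
    (hg : Integrable g) (hg1 : ∫ x, g x = 1) {η Y : ι → ℝ} (hη : Tendsto η l (𝓝[>] 0)) {y : ℝ}
    (hY : Tendsto Y l (𝓝 y)) (hy : ContinuousAt f y) :
    Tendsto (fun i => (f ⋆[ContinuousLinearMap.mul ℝ ℂ, volume] dilate (η i) g) (Y i)) l
      (𝓝 (f y)) := by
  have hη0 : Tendsto η l (𝓝 0) := hη.mono_right nhdsWithin_le_nhds
  have hηpos : ∀ᶠ i in l, 0 < η i := hη.eventually self_mem_nhdsWithin
  have h1 : Tendsto (fun i => ∫ x, f (Y i - η i * x) * g x) l (𝓝 (∫ x, f y * g x)) := by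
    refine tendsto_integral_filter_of_dominated_convergence (fun x => B * ‖g x‖) ?_ ?_
      (hg.norm.const_mul B) (Eventually.of_forall fun x => ?_)
    · filter_upwards [hηpos] with i hi
      have hq : Measure.QuasiMeasurePreserving (fun x : ℝ => η i * x) volume volume :=
        ⟨by fun_prop, by
          rw [Real.map_volume_mul_left hi.ne']
          exact Measure.smul_absolutelyContinuous⟩
      have hq' := (quasiMeasurePreserving_sub_left volume (Y i)).comp hq
      exact (hf.comp_quasiMeasurePreserving hq').mul hg.aestronglyMeasurable
    · refine Eventually.of_forall fun i => Eventually.of_forall fun x => ?_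
      rw [norm_mul]
      exact mul_le_mul_of_nonneg_right (hB _) (norm_nonneg _)
    · have h2 : Tendsto (fun i => Y i - η i * x) l (𝓝 y) := by
        simpa using hY.sub (hη0.mul_const x)
      exact (hy.tendsto.comp h2).mul_const _
  rw [integral_const_mul, hg1, mul_one] at h1
  refine h1.congr' ?_
  filter_upwards [hηpos] with i hi
  exact (convolution_dilate f g hi (Y i)).symm

/-- A family of test functions which, along `φ_ε`, are multiples of dilations `g_η` of a fixed test
function, with polynomially bounded factors; `η φ ε` is the width for the mollifier `φ_ε`. -/
structure IsKernelFamily (η : Index → ℝ → ℝ) (k : Index → ℝ → ℂ) : Prop where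
  smooth : ∀ φ, ContDiff ℝ ∞ (k φ)
  compact : ∀ φ, HasCompactSupport (k φ)
  scaled : ∃ N : ℕ, ∀ φ : Index, ∃ g : ℝ → ℂ, ContDiff ℝ ∞ g ∧ HasCompactSupport g ∧
    ∃ C : ℝ, 0 ≤ C ∧ ∀ᶠ ε in 𝓝[>] (0 : ℝ), ∃ r : ℂ, ‖r‖ ≤ C * ε ^ (-(N : ℤ)) ∧
      k (φ.scale ε) = r • dilate (η φ ε) g

/-- The widths decrease at most linearly. -/
def IsWidth (η : Index → ℝ → ℝ) : Prop :=
  ∀ φ : Index, ∃ C : ℝ, 0 ≤ C ∧ ∀ᶠ ε in 𝓝[>] (0 : ℝ), 0 < η φ ε ∧ (η φ ε)⁻¹ ≤ C * ε⁻¹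

theorem IsKernelFamily.deriv {η : Index → ℝ → ℝ} (hη : IsWidth η) {k : Index → ℝ → ℂ}
    (hk : IsKernelFamily η k) : IsKernelFamily η fun φ => _root_.deriv (k φ) := by
  refine ⟨fun φ => (contDiff_infty_iff_deriv.1 (hk.smooth φ)).2,
    fun φ => (hk.compact φ).deriv, ?_⟩
  obtain ⟨N, hN⟩ := hk.scaled
  refine ⟨N + 1, fun φ => ?_⟩
  obtain ⟨g, hg, hgc, C, hC0, hC⟩ := hN φ
  obtain ⟨A, hA0, hA⟩ := hη φ
  refine ⟨_root_.deriv g, (contDiff_infty_iff_deriv.1 hg).2, hgc.deriv, C * A, by positivity, ?_⟩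
  filter_upwards [hC, hA, self_mem_nhdsWithin] with ε ⟨r, hr, he⟩ ⟨h1, h2⟩ (h3 : 0 < ε)
  refine ⟨r * (η φ ε : ℂ)⁻¹, ?_, ?_⟩
  · rw [norm_mul, norm_inv, Complex.norm_real, Real.norm_of_nonneg h1.le]
    calc ‖r‖ * (η φ ε)⁻¹ ≤ (C * ε ^ (-(N : ℤ))) * (A * ε⁻¹) := by gcongr
      _ = C * A * ε ^ (-((N + 1 : ℕ) : ℤ)) := by
        have : (-((N + 1 : ℕ) : ℤ)) = -(N : ℤ) - 1 := by push_cast; ring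
        rw [this, zpow_sub_one₀ h3.ne']
        ring
  · have h4 : _root_.deriv (r • dilate (η φ ε) g) = r • _root_.deriv (dilate (η φ ε) g) :=
      funext fun x => deriv_const_smul r ((contDiff_dilate hg _).differentiable (by simp) x)
    rw [he, h4, deriv_dilate hg, mul_smul]

theorem fderivWithin_convolution {f k : ℝ → ℂ} (hf : AEStronglyMeasurable f) {B : ℝ}
    (hB : ∀ x, ‖f x‖ ≤ B) (hk : ContDiff ℝ ∞ k) (hkc : HasCompactSupport k) {x : ℝ} (hx : 0 ≤ x) :
    fderivWithin ℝ (f ⋆[ContinuousLinearMap.mul ℝ ℂ, volume] k) halfLine.carrier x 1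
      = (f ⋆[ContinuousLinearMap.mul ℝ ℂ, volume] _root_.deriv k) x := by
  have h1 := hkc.hasDerivAt_convolution_right (ContinuousLinearMap.mul ℝ ℂ)
    (locallyIntegrable_of_bounded hf hB) (hk.of_le (by exact_mod_cast le_top)) x
  rw [h1.hasFDerivAt.hasFDerivWithinAt.fderivWithin (halfLine.uniqueDiff x hx)]
  simp

/-- The regularizations of a bounded function by a kernel family are moderate, since the
derivatives fall on the kernel. -/
theorem growth_convolution {η : Index → ℝ → ℝ} (hη : IsWidth η) {f : ℝ → ℂ}
    (hf : AEStronglyMeasurable f) {B : ℝ} (hB : ∀ x, ‖f x‖ ≤ B) {k : Index → ℝ → ℂ}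
    (hk : IsKernelFamily η k) :
    Growth 0 halfLine fun φ => f ⋆[ContinuousLinearMap.mul ℝ ℂ, volume] k φ := by
  intro K hK hKc n
  induction n generalizing k with
  | zero =>
    rw [growthAt_zero_iff]
    obtain ⟨N, hN⟩ := hk.scaled
    refine ⟨N, fun q _ φ _ => ?_⟩
    obtain ⟨g, hg, hgc, C, hC0, hC⟩ := hN φ
    obtain ⟨A, hA0, hA⟩ := hη φ
    have hB0 : 0 ≤ B := (norm_nonneg _).trans (hB 0)
    have hI : 0 ≤ ∫ y, ‖g y‖ := integral_nonneg fun _ => norm_nonneg _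
    refine ⟨B * (C * ∫ y, ‖g y‖), by positivity, ?_⟩
    filter_upwards [hC, hA] with ε ⟨r, hr, he⟩ ⟨h1, _⟩ x _
    refine (norm_convolution_le hB
      ((hk.smooth _).continuous.integrable_of_hasCompactSupport (hk.compact _)) x).trans ?_
    rw [he]
    simp only [Pi.smul_apply, norm_smul, integral_const_mul, integral_norm_dilate g h1]
    simp only [Pi.zero_apply, zero_sub]
    calc B * (‖r‖ * ∫ y, ‖g y‖) ≤ B * ((C * ε ^ (-(N : ℤ))) * ∫ y, ‖g y‖) := by gcongr
      _ = _ := by ring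
  | succ n ih =>
    refine GrowthAt.succ_line (fun φ => (contDiff_convolution hf hB (hk.smooth φ)
      (hk.compact φ)).contDiffOn) hK ((ih (hk.deriv hη)).congr hK
        fun φ => Eventually.of_forall fun ε x hx => ?_)
    exact fderivWithin_convolution hf hB (hk.smooth _) (hk.compact _) hx

/-! ### The width of a mollifier -/

theorem Index.scale_val (φ : Index) {ε : ℝ} (hε : 0 < ε) : (φ.scale ε).1 = dilate ε φ.1 := by
  have : φ.scale ε = ⟨dilate ε φ.1, φ.2.dilate hε⟩ := dif_pos hε
  rw [this]

theorem Index.tsupport_scale (φ : Index) {ε : ℝ} (hε : 0 < ε) :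
    tsupport (φ.scale ε).1 = (fun x => ε * x) '' tsupport φ.1 := by
  have h1 : Function.support (dilate ε φ.1) = (Homeomorph.mulLeft₀ ε hε.ne') ''
      Function.support φ.1 := by
    ext x
    simp only [Homeomorph.image_eq_preimage_symm, mem_preimage, Function.mem_support, dilate,
      ne_eq, mul_eq_zero, inv_eq_zero, Complex.ofReal_eq_zero, hε.ne', false_or]
    simp [div_eq_inv_mul]
  rw [φ.scale_val hε, tsupport, h1, ← Homeomorph.image_closure]
  rfl

open scoped Pointwise in
theorem Index.width_scale (φ : Index) {ε : ℝ} (hε : 0 < ε) :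
    (φ.scale ε).width = ε * φ.width := by
  have h : (fun x : ℝ => ε * x) '' tsupport φ.1 = ε • tsupport φ.1 := rfl
  rw [Index.width, φ.tsupport_scale hε, h, diam_smul₀, Real.norm_of_nonneg hε.le, Index.width]

theorem Index.width_pos (φ : Index) : 0 < φ.width := by
  refine Metric.diam_pos ?_ φ.2.compact.isCompact.isBounded
  have hne : ∃ x, φ.1 x ≠ 0 := by
    by_contra! h
    have := φ.2.integral_one
    simp [h] at this
  obtain ⟨x, hx⟩ := hne
  have h1 : Function.support φ.1 ∈ 𝓝 x :=
    φ.2.smooth.continuous.continuousAt.eventually_ne hx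
  obtain ⟨y, hyx, hy⟩ := ((accPt_iff_frequently.1
    (PerfectSpace.univ_preperfect x (mem_univ x))).and_eventually h1).exists
  exact ⟨y, subset_tsupport _ hy, x, subset_tsupport _ hx, hyx.1⟩

/-- Along `φ_ε` the logarithmic scale is `1 / log (1 / (ε w))`, `w` the width of `φ`. -/
theorem Index.eventually_logScale (φ : Index) : ∀ᶠ ε in 𝓝[>] (0 : ℝ),
    0 < logScale (φ.scale ε) ∧ (logScale (φ.scale ε))⁻¹ = Real.log (φ.width⁻¹ / ε) := by
  have h1 : ∀ᶠ ε in 𝓝[>] (0 : ℝ), ε < φ.width⁻¹ :=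
    (eventually_lt_nhds (inv_pos.2 φ.width_pos)).filter_mono nhdsWithin_le_nhds
  filter_upwards [h1, self_mem_nhdsWithin] with ε h2 (h3 : 0 < ε)
  have h4 : 0 < ε * φ.width := mul_pos h3 φ.width_pos
  have h5 : ε * φ.width < 1 := by
    have := mul_lt_mul_of_pos_right h2 φ.width_pos
    rwa [inv_mul_cancel₀ φ.width_pos.ne'] at this
  have h6 := Real.log_neg h4 h5
  rw [logScale, φ.width_scale h3, inv_inv, abs_of_neg h6]
  refine ⟨inv_pos.2 (by linarith), ?_⟩
  rw [← Real.log_inv, mul_inv, mul_comm]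
  rfl

theorem Index.tendsto_logScale (φ : Index) :
    Tendsto (fun ε => logScale (φ.scale ε)) (𝓝[>] 0) (𝓝[>] 0) := by
  have h1 : Tendsto (fun ε : ℝ => (Real.log (φ.width⁻¹ / ε))⁻¹) (𝓝[>] 0) (𝓝 0) := by
    refine tendsto_inv_atTop_zero.comp (Real.tendsto_log_atTop.comp ?_)
    change Tendsto (fun ε : ℝ => φ.width⁻¹ * ε⁻¹) _ _
    exact tendsto_inv_nhdsGT_zero.const_mul_atTop (inv_pos.2 φ.width_pos)
  refine tendsto_nhdsWithin_iff.2 ⟨h1.congr' ?_, ?_⟩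
  · filter_upwards [φ.eventually_logScale] with ε h
    rw [← h.2, inv_inv]
  · filter_upwards [φ.eventually_logScale] with ε h using h.1

theorem isWidth_logScale : IsWidth fun φ ε => logScale (φ.scale ε) := fun φ => by
  refine ⟨φ.width⁻¹, (inv_pos.2 φ.width_pos).le, ?_⟩
  filter_upwards [φ.eventually_logScale, self_mem_nhdsWithin] with ε h (h0 : 0 < ε)
  refine ⟨h.1, ?_⟩
  rw [h.2]
  have h1 : 0 < φ.width⁻¹ / ε := div_pos (inv_pos.2 φ.width_pos) h0
  have := Real.log_le_sub_one_of_pos h1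
  rw [← div_eq_mul_inv]
  linarith

/-! ### The regularized data -/

theorem isWidth_id : IsWidth fun _ ε => ε := fun _ => ⟨1, zero_le_one, by
  filter_upwards [self_mem_nhdsWithin] with ε h using ⟨h, (one_mul _).ge⟩⟩

theorem isKernelFamily_mollifier : IsKernelFamily (fun _ ε => ε) fun φ => φ.1 :=
  ⟨fun φ => φ.2.smooth, fun φ => φ.2.compact, 0, fun φ =>
    ⟨φ.1, φ.2.smooth, φ.2.compact, 1, zero_le_one, by
      filter_upwards [self_mem_nhdsWithin] with ε (h : 0 < ε)
      exact ⟨1, by simp, by rw [φ.scale_val h, one_smul]⟩⟩⟩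

theorem Index.integrable (φ : Index) : Integrable φ.1 :=
  φ.2.smooth.continuous.integrable_of_hasCompactSupport φ.2.compact

/-- A function which is continuous almost everywhere is almost everywhere measurable. -/
theorem aestronglyMeasurable_of_ae_continuousAt {f : ℝ → ℂ} (hf : ∀ᵐ x, ContinuousAt f x) :
    AEStronglyMeasurable f := by
  obtain ⟨t, ht, htm, ht0⟩ := exists_measurable_superset_of_null (ae_iff.1 hf)
  have hc : ContinuousOn f tᶜ := fun x hx => by
    have : ContinuousAt f x := by
      by_contra h
      exact hx (ht h)
    exact this.continuousWithinAt
  have h1 := hc.aestronglyMeasurable (μ := volume) htm.compl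
  rwa [Measure.restrict_eq_self_of_ae_mem] at h1
  exact measure_eq_zero_iff_ae_notMem.1 ht0

/-- Bounded functions on the half line which are continuous almost everywhere and vanish on
`[0, δ)`: the admissible initial data. -/
structure IsDatum (w : ℝ → ℂ) (δ B : ℝ) : Prop where
  pos : 0 < δ
  bound : ∀ x, 0 ≤ x → ‖w x‖ ≤ B
  cont : ∀ᵐ x ∂volume.restrict (Ici (0 : ℝ)), ContinuousWithinAt w (Ici 0) x
  nil : ∀ x, 0 ≤ x → x < δ → w x = 0

/-- The regularization `w * φ` of an initial datum, replaced by zero unless the support of `φ` is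
contained in a small ball; it then vanishes near the origin for all `φ`. -/
def cutData (δ : ℝ) (w : ℝ → ℂ) : Index → ℝ → ℂ := fun φ =>
  open Classical in if tsupport φ.1 ⊆ Metric.ball 0 (δ / 2) then dataRep w φ else 0

namespace IsDatum

variable {w : ℝ → ℂ} {δ B : ℝ} (h : IsDatum w δ B)
include h

theorem bound_nonneg : 0 ≤ B := (norm_nonneg _).trans (h.bound 0 le_rfl)

theorem norm_indicator_le (x : ℝ) : ‖(Ici (0 : ℝ)).indicator w x‖ ≤ B := by
  by_cases hx : x ∈ Ici (0 : ℝ)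
  · rw [indicator_of_mem hx]
    exact h.bound x hx
  · rw [indicator_of_notMem hx, norm_zero]
    exact h.bound_nonneg

theorem indicator_eq_zero {x : ℝ} (hx : x < δ) : (Ici (0 : ℝ)).indicator w x = 0 := by
  by_cases hx0 : x ∈ Ici (0 : ℝ)
  · rw [indicator_of_mem hx0, h.nil x hx0 hx]
  · rw [indicator_of_notMem hx0]

theorem ae_continuousAt : ∀ᵐ x, ContinuousAt ((Ici (0 : ℝ)).indicator w) x := by
  have h1 := (ae_restrict_iff' measurableSet_Ici).1 h.cont
  filter_upwards [h1] with x hx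
  rcases lt_or_ge x δ with hxδ | hxδ
  · refine (continuousAt_const (y := (0 : ℂ))).congr ?_
    filter_upwards [Iio_mem_nhds hxδ] with y hy
    exact (h.indicator_eq_zero hy).symm
  · have hx0 : 0 < x := h.pos.trans_le hxδ
    refine ((hx hx0.le).continuousAt (Ici_mem_nhds hx0)).congr ?_
    filter_upwards [Ici_mem_nhds hx0] with y hy
    rw [indicator_of_mem hy]

theorem aestronglyMeasurable : AEStronglyMeasurable ((Ici (0 : ℝ)).indicator w) :=
  aestronglyMeasurable_of_ae_continuousAt h.ae_continuousAt

theorem contDiff_dataRep (φ : Index) : ContDiff ℝ ∞ (dataRep w φ) :=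
  contDiff_convolution h.aestronglyMeasurable h.norm_indicator_le φ.2.smooth φ.2.compact

theorem dataRep_mem : dataRep w ∈ Moderate halfLine :=
  mem_moderate_iff.2 ⟨fun φ => (h.contDiff_dataRep φ).contDiffOn,
    growth_convolution isWidth_id h.aestronglyMeasurable h.norm_indicator_le
      isKernelFamily_mollifier⟩

theorem contDiff_cutData (φ : Index) : ContDiff ℝ ∞ (cutData δ w φ) := by
  unfold cutData
  split_ifs
  · exact h.contDiff_dataRep φ
  · exact contDiff_const

theorem eventually_cutData (φ : Index) :
    ∀ᶠ ε in 𝓝[>] (0 : ℝ), cutData δ w (φ.scale ε) = dataRep w (φ.scale ε) := by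
  obtain ⟨R, hR⟩ := φ.2.compact.isCompact.isBounded.subset_ball 0
  have hδ := h.pos
  have h1 : ∀ᶠ ε in 𝓝[>] (0 : ℝ), ε < δ / 2 / max R 1 :=
    (eventually_lt_nhds (by positivity)).filter_mono nhdsWithin_le_nhds
  filter_upwards [h1, self_mem_nhdsWithin] with ε h2 (h3 : 0 < ε)
  rw [cutData, if_pos]
  rw [φ.tsupport_scale h3]
  rintro _ ⟨x, hx, rfl⟩
  have h4 := hR hx
  rw [mem_ball_zero_iff] at h4 ⊢
  rw [norm_mul, Real.norm_of_nonneg h3.le]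
  have h5 : ε * max R 1 < δ / 2 := (lt_div_iff₀ (by positivity)).1 h2
  exact (mul_le_mul_of_nonneg_left (h4.le.trans (le_max_left R 1)) h3.le).trans_lt h5

theorem cutData_eq_zero (φ : Index) {x : ℝ} (hx : x < δ / 2) : cutData δ w φ x = 0 := by
  unfold cutData
  split_ifs with hφ
  · refine integral_eq_zero_of_ae (Eventually.of_forall fun t => ?_)
    simp only [ContinuousLinearMap.mul_apply', Pi.zero_apply, mul_eq_zero]
    rcases lt_or_ge t δ with ht | ht
    · exact Or.inl (h.indicator_eq_zero ht)
    · refine Or.inr (image_eq_zero_of_notMem_tsupport fun hm => ?_)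
      have := hφ hm
      rw [mem_ball_zero_iff, Real.norm_eq_abs, abs_lt] at this
      linarith [this.1]
  · rfl

theorem cutData_mem : cutData δ w ∈ Moderate halfLine :=
  mem_moderate_iff.2 ⟨fun φ => (h.contDiff_cutData φ).contDiffOn,
    (mem_moderate_iff.1 h.dataRep_mem).2.congr fun φ => by
      filter_upwards [h.eventually_cutData φ] with ε hε x _
      rw [hε]⟩

theorem mk_cutData : Ideal.Quotient.mk (Negligible halfLine) ⟨cutData δ w, h.cutData_mem⟩
    = Ideal.Quotient.mk (Negligible halfLine) ⟨dataRep w, h.dataRep_mem⟩ := by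
  rw [mk_eq_mk_iff]
  refine growth_of_eventually_zero fun φ => ?_
  filter_upwards [h.eventually_cutData φ] with ε hε x _
  simp [hε]

theorem norm_cutData_le (φ : Index) (x : ℝ) : ‖cutData δ w φ x‖ ≤ B * ∫ y, ‖φ.1 y‖ := by
  unfold cutData
  split_ifs
  · exact norm_convolution_le h.norm_indicator_le φ.integrable x
  · have : 0 ≤ ∫ y, ‖φ.1 y‖ := integral_nonneg fun _ => norm_nonneg _
    simpa using mul_nonneg h.bound_nonneg this

theorem eventually_norm_cutData_le (φ : Index) :
    ∀ᶠ ε in 𝓝[>] (0 : ℝ), ∀ x, ‖cutData δ w (φ.scale ε) x‖ ≤ B * ∫ y, ‖φ.1 y‖ := by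
  filter_upwards [self_mem_nhdsWithin] with ε (hε : 0 < ε) x
  refine (h.norm_cutData_le _ x).trans_eq ?_
  rw [φ.scale_val hε, integral_norm_dilate _ hε]

theorem tendsto_cutData (φ : Index) {Y : ℝ → ℝ} {y : ℝ} (hY : Tendsto Y (𝓝[>] 0) (𝓝 y))
    (hy : ContinuousAt ((Ici (0 : ℝ)).indicator w) y) :
    Tendsto (fun ε => cutData δ w (φ.scale ε) (Y ε)) (𝓝[>] 0)
      (𝓝 ((Ici (0 : ℝ)).indicator w y)) := by
  refine (tendsto_convolution_dilate h.aestronglyMeasurable h.norm_indicator_le φ.integrable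
    φ.2.integral_one (η := id) tendsto_id hY hy).congr' ?_
  filter_upwards [h.eventually_cutData φ, self_mem_nhdsWithin] with ε h1 (h2 : 0 < ε)
  rw [h1, dataRep, φ.scale_val h2, id]

theorem nilNearZero : NilNearZero (Ideal.Quotient.mk (Negligible halfLine)
    ⟨dataRep w, h.dataRep_mem⟩) :=
  ⟨cutData δ w, ⟨h.cutData_mem, h.mk_cutData⟩, fun φ => ⟨δ / 2, half_pos h.pos, fun _ _ hx =>
    h.cutData_eq_zero φ hx⟩⟩

end IsDatum

/-! ### Association with bounded functions -/

/-- A generalized function whose representative is bounded and converges almost everywhere is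
associated with the limit, by dominated convergence. -/
theorem isAssociated_of_tendsto {E : Type*} [NormedAddCommGroup E] [NormedSpace ℝ E]
    [MeasureSpace E] [BorelSpace E] [SecondCountableTopology E]
    [IsFiniteMeasureOnCompacts (volume : Measure E)]
    [IsLocallyFiniteMeasure (volume : Measure E)] {Ω : Domain E}
    (hΩ : MeasurableSet Ω.carrier) {u : Index → E → ℂ} {U : G Ω} (hu : IsRep u U) {w : E → ℂ}
    (hw : AEStronglyMeasurable w (volume.restrict Ω.carrier)) {B' : ℝ}
    (hwb : ∀ x ∈ Ω.carrier, ‖w x‖ ≤ B')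
    (hb : ∀ φ : Index, ∃ B : ℝ, ∀ᶠ ε in 𝓝[>] (0 : ℝ), ∀ x ∈ Ω.carrier, ‖u (φ.scale ε) x‖ ≤ B)
    (hlim : ∀ φ : Index, ∀ᵐ x ∂volume.restrict Ω.carrier,
      Tendsto (fun ε => u (φ.scale ε) x) (𝓝[>] 0) (𝓝 (w x))) : IsAssociated U w := by
  refine ⟨locallyIntegrableOn_of_locallyIntegrable_restrict ?_, u, hu, fun ψ hψ hψc =>
    ⟨0, fun φ _ => ?_⟩⟩
  · have h : LocallyIntegrable (fun _ : E => B') (volume.restrict Ω.carrier) :=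
      locallyIntegrable_const B'
    refine h.mono hw ?_
    filter_upwards [ae_restrict_mem hΩ] with x hx using (hwb x hx).trans (le_abs_self B')
  · obtain ⟨B, hB⟩ := hb φ
    obtain ⟨hmem, -⟩ := hu
    have hψi : Integrable ψ (volume.restrict Ω.carrier) :=
      (hψ.continuous.integrable_of_hasCompactSupport hψc).restrict
    refine tendsto_integral_filter_of_dominated_convergence (fun x => B * ‖ψ x‖) ?_ ?_
      (hψi.norm.const_mul B) ?_
    · exact Eventually.of_forall fun ε =>
        ((hmem.1 (φ.scale ε)).continuousOn.aestronglyMeasurable hΩ).mul hψi.aestronglyMeasurable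
    · filter_upwards [hB] with ε hε
      filter_upwards [ae_restrict_mem hΩ] with x hx
      rw [norm_mul]
      exact mul_le_mul_of_nonneg_right (hε x hx) (norm_nonneg _)
    · filter_upwards [hlim φ] with x hx using hx.mul_const _

theorem IsDatum.isAssociated {w : ℝ → ℂ} {δ B : ℝ} (h : IsDatum w δ B) :
    IsAssociated (Ideal.Quotient.mk (Negligible halfLine) ⟨dataRep w, h.dataRep_mem⟩) w := by
  have hm : MeasurableSet halfLine.carrier := measurableSet_Ici
  have hw : (Ici (0 : ℝ)).indicator w =ᵐ[volume.restrict halfLine.carrier] w :=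
    indicator_ae_eq_restrict measurableSet_Ici
  refine isAssociated_of_tendsto hm (u := cutData δ w) ⟨h.cutData_mem, h.mk_cutData⟩
    (h.aestronglyMeasurable.restrict.congr hw) h.bound
    (fun φ => ⟨B * ∫ y, ‖φ.1 y‖, ?_⟩) fun φ => ?_
  · filter_upwards [h.eventually_norm_cutData_le φ] with ε hε x _ using hε x
  · filter_upwards [ae_restrict_of_ae h.ae_continuousAt, hw] with x hx hx'
    rw [← hx']
    exact h.tendsto_cutData φ tendsto_const_nhds hx

/-! ### The regularized speed -/

/-- Two media with wave speeds `cL` and `cR`, with interface at `x₀`. -/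
structure IsMedium (cL cR x₀ : ℝ) : Prop where
  left_pos : 0 < cL
  right_pos : 0 < cR
  interface_pos : 0 < x₀

/-- The hypotheses on the media and on the kernel `ρ` by which the speed is regularized. -/
structure IsRegularizer (cL cR x₀ : ℝ) (ρ : ℝ → ℝ) : Prop extends IsMedium cL cR x₀ where
  smooth : ContDiff ℝ ∞ ρ
  compact : HasCompactSupport ρ
  integral_one : ∫ x, ρ x = 1
  pos : ∀ η : ℝ, 0 < η → ∀ x : ℝ, 0 < smear (speed cL cR x₀) ρ η x

theorem measurable_speed (cL cR x₀ : ℝ) : Measurable (speed cL cR x₀) :=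
  Measurable.ite measurableSet_Iio measurable_const measurable_const

theorem continuousAt_speed (cL cR : ℝ) {x₀ x : ℝ} (hx : x ≠ x₀) :
    ContinuousAt (speed cL cR x₀) x := by
  rcases lt_or_gt_of_ne hx with hx | hx
  · refine (continuousAt_const (y := cL)).congr ?_
    filter_upwards [Iio_mem_nhds hx] with y (hy : y < x₀)
    simp [speed, hy]
  · refine (continuousAt_const (y := cR)).congr ?_
    filter_upwards [Ioi_mem_nhds hx] with y (hy : x₀ < y)
    simp [speed, hy.le]

theorem ofReal_smear (c ρ : ℝ → ℝ) (η x : ℝ) : ((smear c ρ η x : ℝ) : ℂ)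
    = ((fun y => (c y : ℂ)) ⋆[ContinuousLinearMap.mul ℝ ℂ, volume]
        dilate η fun y => (ρ y : ℂ)) x := by
  simp only [smear, convolution, ContinuousLinearMap.mul_apply', dilate]
  rw [← integral_complex_ofReal]
  push_cast
  rfl

namespace IsRegularizer

variable {cL cR x₀ : ℝ} {ρ : ℝ → ℝ} (h : IsRegularizer cL cR x₀ ρ)
include h

theorem speed_mem (x : ℝ) : 0 < speed cL cR x₀ x ∧ speed cL cR x₀ x ≤ max cL cR := by
  unfold speed
  split_ifs
  · exact ⟨h.left_pos, le_max_left _ _⟩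
  · exact ⟨h.right_pos, le_max_right _ _⟩

theorem norm_speed_le (x : ℝ) : ‖(speed cL cR x₀ x : ℂ)‖ ≤ max cL cR := by
  rw [Complex.norm_real, Real.norm_of_nonneg (h.speed_mem x).1.le]
  exact (h.speed_mem x).2

omit h in
theorem aestronglyMeasurable_speed : AEStronglyMeasurable fun x => (speed cL cR x₀ x : ℂ) :=
  (Complex.measurable_ofReal.comp (measurable_speed cL cR x₀)).aestronglyMeasurable

theorem contDiff_kernel : ContDiff ℝ ∞ fun y => (ρ y : ℂ) :=
  Complex.ofRealCLM.contDiff.comp h.smooth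

theorem compact_kernel : HasCompactSupport fun y => (ρ y : ℂ) :=
  h.compact.comp_left (g := fun r : ℝ => (r : ℂ)) Complex.ofReal_zero

theorem integrable_kernel : Integrable fun y => (ρ y : ℂ) :=
  h.contDiff_kernel.continuous.integrable_of_hasCompactSupport h.compact_kernel

theorem integral_kernel : ∫ y, (ρ y : ℂ) = 1 := by
  rw [integral_complex_ofReal, h.integral_one, Complex.ofReal_one]

theorem contDiff_smear (η : ℝ) : ContDiff ℝ ∞ (smear (speed cL cR x₀) ρ η) := by
  have h1 := contDiff_convolution (aestronglyMeasurable_speed (cL := cL) (cR := cR) (x₀ := x₀))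
    h.norm_speed_le (contDiff_dilate h.contDiff_kernel η) (hasCompactSupport_dilate h.compact_kernel η)
  have h2 := Complex.reCLM.contDiff.comp h1
  convert h2 using 1
  ext x
  simp [← ofReal_smear]

omit h in
/-- The speed is invariant under dilations about the interface, so that all regularizations are
dilations of a single one. -/
theorem smear_eq {η : ℝ} (hη : 0 < η) (x : ℝ) : smear (speed cL cR x₀) ρ η x
    = smear (speed cL cR x₀) ρ 1 (x₀ + (x - x₀) / η) := by
  apply Complex.ofReal_injective
  rw [ofReal_smear, ofReal_smear, convolution_dilate _ _ hη, convolution_dilate _ _ one_pos]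
  refine integral_congr_ae (Eventually.of_forall fun y => ?_)
  have : x - η * y < x₀ ↔ x₀ + (x - x₀) / η - 1 * y < x₀ := by
    have e : x₀ + (x - x₀) / η - 1 * y - x₀ = (x - η * y - x₀) / η := by field_simp; ring
    rw [← sub_neg, ← sub_neg (a := x₀ + (x - x₀) / η - 1 * y), e, div_neg_iff]
    constructor
    · intro h; exact Or.inr ⟨h, hη⟩
    · rintro (h | h)
      · linarith [h.2]
      · exact h.1
  simp only [speed, this]

/-- Away from the interface, at a distance given by the support of `ρ`, the speed is not changed. -/
theorem exists_smear_const : ∃ r : ℝ, 0 < r ∧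
    (∀ z ≤ x₀ - r, smear (speed cL cR x₀) ρ 1 z = cL) ∧
    (∀ z ≥ x₀ + r, smear (speed cL cR x₀) ρ 1 z = cR) := by
  obtain ⟨R, hR⟩ := h.compact.isCompact.isBounded.subset_ball 0
  have hR' : ∀ y, max R 1 ≤ |y| → ρ y = 0 := fun y hy => by
    refine image_eq_zero_of_notMem_tsupport fun hm => ?_
    have := hR hm
    rw [mem_ball_zero_iff, Real.norm_eq_abs] at this
    linarith [le_max_left R 1]
  refine ⟨max R 1, by positivity, fun z hz => ?_, fun z hz => ?_⟩ <;>
  · apply Complex.ofReal_injective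
    rw [ofReal_smear, convolution_dilate _ _ one_pos]
    simp only [one_mul]
    conv_rhs => rw [← mul_one (Complex.ofReal _), ← h.integral_kernel, ← integral_const_mul]
    refine integral_congr_ae (Eventually.of_forall fun y => ?_)
    rcases le_or_gt (max R 1) |y| with hy | hy
    · simp [hR' y hy]
    · have hy1 := abs_lt.1 hy
      simp only [speed]
      first
      | rw [if_pos (by linarith [hy1.1])]
      | rw [if_neg (by linarith [hy1.2])]

/-- Uniform bounds for all regularizations at once: by dilation invariance they take the values of a
single function, which is positive and constant outside a compact interval. -/
theorem exists_isSpeed : ∃ m M : ℝ,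
    ∀ η, 0 < η → IsSpeed (smear (speed cL cR x₀) ρ η) m M := by
  obtain ⟨r, hr, hl, hr'⟩ := h.exists_smear_const
  set f := smear (speed cL cR x₀) ρ 1 with hf
  have hc : ContinuousOn f (Icc (x₀ - r) (x₀ + r)) := (h.contDiff_smear 1).continuous.continuousOn
  have hne : (Icc (x₀ - r) (x₀ + r)).Nonempty := nonempty_Icc.2 (by linarith)
  obtain ⟨a, -, ha⟩ := isCompact_Icc.exists_isMinOn hne hc
  obtain ⟨b, -, hb⟩ := isCompact_Icc.exists_isMaxOn hne hc
  have key : ∀ z, f a ≤ f z ∧ f z ≤ f b := by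
    intro z
    by_cases h1 : z ≤ x₀ - r
    · have e : f z = f (x₀ - r) := by rw [hl z h1, hl _ le_rfl]
      rw [e]
      exact ⟨ha (left_mem_Icc.2 (by linarith)), hb (left_mem_Icc.2 (by linarith))⟩
    by_cases h2 : x₀ + r ≤ z
    · have e : f z = f (x₀ + r) := by rw [hr' z h2, hr' _ le_rfl]
      rw [e]
      exact ⟨ha (right_mem_Icc.2 (by linarith)), hb (right_mem_Icc.2 (by linarith))⟩
    · exact ⟨ha ⟨by linarith, by linarith⟩, hb ⟨by linarith, by linarith⟩⟩
  have ha0 : 0 < f a := h.pos 1 one_pos a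
  refine ⟨f a, f b, fun η hη => ⟨h.contDiff_smear η, ha0, fun x => ?_, fun x => ?_⟩⟩ <;>
    rw [smear_eq hη]
  · exact (key _).1
  · exact (key _).2

omit h in
theorem speedRep_eq : speedRep (speed cL cR x₀) ρ = fun φ =>
    (fun y => (speed cL cR x₀ y : ℂ)) ⋆[ContinuousLinearMap.mul ℝ ℂ, volume]
        dilate (logScale φ) fun y => (ρ y : ℂ) := by
  ext φ x
  exact ofReal_smear _ _ _ _

theorem isKernelFamily : IsKernelFamily (fun φ ε => logScale (φ.scale ε))
    fun φ => dilate (logScale φ) fun y => (ρ y : ℂ) :=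
  ⟨fun φ => contDiff_dilate h.contDiff_kernel _, fun φ => hasCompactSupport_dilate h.compact_kernel _,
    0, fun φ => ⟨_, h.contDiff_kernel, h.compact_kernel, 1, zero_le_one,
      Eventually.of_forall fun ε => ⟨1, by simp, by rw [one_smul]⟩⟩⟩

theorem speedRep_mem : speedRep (speed cL cR x₀) ρ ∈ Moderate halfLine := by
  rw [mem_moderate_iff, speedRep_eq]
  exact ⟨fun φ => (contDiff_convolution aestronglyMeasurable_speed h.norm_speed_le
      (h.isKernelFamily.smooth φ) (h.isKernelFamily.compact φ)).contDiffOn,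
    growth_convolution isWidth_logScale aestronglyMeasurable_speed h.norm_speed_le
      h.isKernelFamily⟩

omit h in
theorem smear_zero (c : ℝ → ℝ) : smear c ρ 0 = 0 := by
  ext x
  simp [smear, convolution]

theorem exists_isSpeedFamily : ∃ m M : ℝ,
    IsSpeedFamily (fun φ => smear (speed cL cR x₀) ρ (logScale φ)) m M := by
  obtain ⟨m, M, hs⟩ := h.exists_isSpeed
  refine ⟨m, M, fun φ => ?_, fun φ => ?_, (mem_moderate_iff.1 h.speedRep_mem).2⟩
  · rcases eq_or_lt_of_le (show 0 ≤ logScale φ from inv_nonneg.2 (abs_nonneg _)) with h0 | h0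
    · exact Or.inl (by rw [← h0, smear_zero])
    · exact Or.inr (hs _ h0)
  · filter_upwards [φ.eventually_logScale] with ε hε using hs _ hε.1

theorem tendsto_speedRep (φ : Index) {x : ℝ} (hx : x ≠ x₀) :
    Tendsto (fun ε => speedRep (speed cL cR x₀) ρ (φ.scale ε) x) (𝓝[>] 0)
      (𝓝 (speed cL cR x₀ x : ℂ)) := by
  rw [speedRep_eq]
  exact tendsto_convolution_dilate aestronglyMeasurable_speed h.norm_speed_le h.integrable_kernel
    h.integral_kernel φ.tendsto_logScale tendsto_const_nhds
    (Complex.continuous_ofReal.continuousAt.comp (continuousAt_speed cL cR hx))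

theorem norm_speedRep_le (φ : Index) : ∀ᶠ ε in 𝓝[>] (0 : ℝ), ∀ x,
    ‖speedRep (speed cL cR x₀) ρ (φ.scale ε) x‖ ≤ max cL cR * ∫ y, ‖(ρ y : ℂ)‖ := by
  filter_upwards [φ.eventually_logScale] with ε hε x
  rw [speedRep_eq, ← integral_norm_dilate _ hε.1]
  exact norm_convolution_le h.norm_speed_le ((h.isKernelFamily.smooth _).continuous
    |>.integrable_of_hasCompactSupport (h.isKernelFamily.compact _)) x

theorem isAssociated_speed : IsAssociated
    (Ideal.Quotient.mk (Negligible halfLine) ⟨speedRep (speed cL cR x₀) ρ, h.speedRep_mem⟩)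
    fun x => (speed cL cR x₀ x : ℂ) := by
  refine isAssociated_of_tendsto measurableSet_Ici ⟨h.speedRep_mem, rfl⟩
    aestronglyMeasurable_speed.restrict (fun x _ => h.norm_speed_le x)
    (fun φ => ⟨max cL cR * ∫ y, ‖(ρ y : ℂ)‖, ?_⟩)
    fun φ => ?_
  · exact (h.norm_speedRep_le φ).mono fun ε hε x _ => hε x
  · have : ∀ᵐ x : ℝ, x ≠ x₀ := Measure.ae_ne volume x₀
    filter_upwards [ae_restrict_of_ae this] with x hx using h.tendsto_speedRep φ hx

theorem globallyBounded_speed : GloballyBounded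
    (Ideal.Quotient.mk (Negligible halfLine) ⟨speedRep (speed cL cR x₀) ρ, h.speedRep_mem⟩) := by
  refine ⟨_, ⟨h.speedRep_mem, rfl⟩, 0, fun φ _ =>
    ⟨max (max cL cR * ∫ y, ‖(ρ y : ℂ)‖) 1, by positivity, ?_⟩⟩
  exact (h.norm_speedRep_le φ).mono fun ε hε x _ => (hε x).trans (le_max_left _ _)

/-- The derivative of the regularized speed is at most a constant times `1 / η`, that is,
`log (1 / (ε w))` for the width `w` of the mollifier. -/
theorem locallyLogGrowth_speed : LocallyLogGrowth (deriv (1 : ℝ)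
    (Ideal.Quotient.mk (Negligible halfLine) ⟨speedRep (speed cL cR x₀) ρ, h.speedRep_mem⟩)) := by
  refine ⟨(derivModerate halfLine 1 ⟨_, h.speedRep_mem⟩).1,
    ⟨(derivModerate halfLine 1 ⟨_, h.speedRep_mem⟩).2, rfl⟩, fun K hK _ => ?_⟩
  set A := max cL cR * ∫ y, ‖_root_.deriv (fun y => (ρ y : ℂ)) y‖ with hA
  obtain ⟨N, hN⟩ := exists_nat_ge A
  refine ⟨N, fun φ _ => ⟨φ.width⁻¹, inv_pos.2 φ.width_pos, ?_⟩⟩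
  filter_upwards [φ.eventually_logScale] with ε hε x hx
  have h1 : fderivWithin ℝ (speedRep (speed cL cR x₀) ρ (φ.scale ε)) halfLine.carrier x 1
      = ((fun y => (speed cL cR x₀ y : ℂ)) ⋆[ContinuousLinearMap.mul ℝ ℂ, volume]
        _root_.deriv (dilate (logScale (φ.scale ε)) fun y => (ρ y : ℂ))) x := by
    rw [speedRep_eq]
    exact fderivWithin_convolution aestronglyMeasurable_speed h.norm_speed_le
      (h.isKernelFamily.smooth _) (h.isKernelFamily.compact _) (hK hx)
  change ‖fderivWithin ℝ (speedRep (speed cL cR x₀) ρ (φ.scale ε)) halfLine.carrier x 1‖ ≤ _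
  rw [h1, ← hε.2]
  have hd : ContDiff ℝ ∞ (_root_.deriv fun y => (ρ y : ℂ)) :=
    (contDiff_infty_iff_deriv.1 h.contDiff_kernel).2
  refine (norm_convolution_le h.norm_speed_le (((contDiff_infty_iff_deriv.1
    (h.isKernelFamily.smooth _)).2.continuous).integrable_of_hasCompactSupport
      (h.isKernelFamily.compact _).deriv) x).trans ?_
  rw [deriv_dilate h.contDiff_kernel]
  simp only [Pi.smul_apply, norm_smul, integral_const_mul, integral_norm_dilate _ hε.1, norm_inv,
    Complex.norm_real, Real.norm_of_nonneg hε.1.le]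
  calc max cL cR * ((logScale (φ.scale ε))⁻¹ * ∫ y, ‖_root_.deriv (fun y => (ρ y : ℂ)) y‖)
      = A * (logScale (φ.scale ε))⁻¹ := by rw [hA]; ring
    _ ≤ N * (logScale (φ.scale ε))⁻¹ := mul_le_mul_of_nonneg_right hN (inv_pos.2 hε.1).le

end IsRegularizer

/-! ### The characteristics of the discontinuous speed -/

theorem quasiMeasurePreserving_mul_left {c : ℝ} (hc : c ≠ 0) :
    Measure.QuasiMeasurePreserving (fun x : ℝ => c * x) volume volume :=
  ⟨by fun_prop, by
    rw [Real.map_volume_mul_left hc]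
    exact Measure.smul_absolutelyContinuous⟩

/-- The maps `(x, t) ↦ T x + t` used to follow characteristics pull null sets back to null sets. -/
theorem quasiMeasurePreserving_add_shear {T : ℝ → ℝ} (hT : Continuous T) :
    Measure.QuasiMeasurePreserving (fun p : ℝ × ℝ => T p.1 + p.2) volume volume := by
  have h1 : MeasurePreserving (fun p : ℝ × ℝ => (p.1, T p.1 + p.2)) (volume.prod volume)
      (volume.prod volume) :=
    (MeasurePreserving.id volume).skew_product (g := fun x t => T x + t)
      (by fun_prop) (Eventually.of_forall fun x => (measurePreserving_add_left volume (T x)).map_eq)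
  exact Measure.quasiMeasurePreserving_snd.comp h1.quasiMeasurePreserving

theorem quasiMeasurePreserving_sub_shear {T : ℝ → ℝ} (hT : Continuous T) :
    Measure.QuasiMeasurePreserving (fun p : ℝ × ℝ => T p.1 - p.2) volume volume := by
  have h1 := (Measure.measurePreserving_neg (volume : Measure ℝ)).quasiMeasurePreserving.comp
    (quasiMeasurePreserving_add_shear hT.neg)
  convert h1 using 1
  ext p
  simp only [Function.comp_apply, Pi.neg_apply]
  ring

namespace IsMedium

variable {cL cR x₀ : ℝ} (h : IsMedium cL cR x₀)
include h

theorem travelTime_zero : travelTime cL cR x₀ 0 = 0 := by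
  simp [travelTime, h.interface_pos.le]

theorem continuous_travelTime : Continuous (travelTime cL cR x₀) :=
  Continuous.if_le (by fun_prop) (by fun_prop) (by fun_prop) (by fun_prop)
    (by rintro x rfl; simp)

theorem continuous_position : Continuous (position cL cR x₀) :=
  Continuous.if_le (by fun_prop) (by fun_prop) (by fun_prop) (by fun_prop)
    (by
      have := h.left_pos.ne'
      rintro s rfl
      field_simp
      simp [mul_comm])

theorem travelTime_position (s : ℝ) : travelTime cL cR x₀ (position cL cR x₀ s) = s := by
  have h1 := h.left_pos
  have h2 := h.right_pos
  unfold position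
  split_ifs with hs
  · have : cL * s ≤ x₀ := by rwa [le_div_iff₀ h1, mul_comm] at hs
    rw [travelTime, if_pos this, mul_div_cancel_left₀ _ h1.ne']
  · have h3 : 0 < cR * (s - x₀ / cL) := mul_pos h2 (by linarith)
    rw [travelTime, if_neg (by linarith), add_sub_cancel_left, mul_div_cancel_left₀ _ h2.ne']
    ring

theorem position_travelTime (x : ℝ) : position cL cR x₀ (travelTime cL cR x₀ x) = x := by
  have h1 := h.left_pos
  have h2 := h.right_pos
  unfold travelTime
  split_ifs with hx
  · rw [position, if_pos (by gcongr), mul_div_cancel₀ _ h1.ne']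
  · have h3 : 0 < (x - x₀) / cR := div_pos (by linarith) h2
    rw [position, if_neg (by linarith), add_sub_cancel_left, mul_div_cancel₀ _ h2.ne']
    ring

theorem travelTime_nonneg {x : ℝ} (hx : 0 ≤ x) : 0 ≤ travelTime cL cR x₀ x := by
  have h1 := h.left_pos
  have h2 := h.right_pos
  have h3 := h.interface_pos
  unfold travelTime
  split_ifs with hx'
  · positivity
  · have : 0 < x - x₀ := by linarith
    positivity

theorem position_nonneg {s : ℝ} (hs : 0 ≤ s) : 0 ≤ position cL cR x₀ s := by
  have h1 := h.left_pos
  have h2 := h.right_pos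
  have h3 := h.interface_pos
  unfold position
  split_ifs with hs'
  · positivity
  · have : 0 < s - x₀ / cL := by linarith
    positivity

theorem position_nonpos {s : ℝ} (hs : s ≤ 0) : position cL cR x₀ s ≤ 0 := by
  rw [position, if_pos (hs.trans (div_pos h.interface_pos h.left_pos).le)]
  exact mul_nonpos_of_nonneg_of_nonpos h.left_pos.le hs

theorem quasiMeasurePreserving_position :
    Measure.QuasiMeasurePreserving (position cL cR x₀) volume volume := by
  refine ⟨h.continuous_position.measurable, Measure.AbsolutelyContinuous.mk fun A hA h0 => ?_⟩
  rw [Measure.map_apply h.continuous_position.measurable hA]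
  have q1 := quasiMeasurePreserving_mul_left h.left_pos.ne'
  have q2 : Measure.QuasiMeasurePreserving (fun s => x₀ + cR * (s - x₀ / cL)) volume volume :=
    (measurePreserving_add_left volume x₀).quasiMeasurePreserving.comp
      ((quasiMeasurePreserving_mul_left h.right_pos.ne').comp
        (measurePreserving_sub_right volume (x₀ / cL)).quasiMeasurePreserving)
  refine measure_mono_null (fun s hs => ?_)
    (measure_union_null (q1.preimage_null h0) (q2.preimage_null h0))
  simp only [mem_preimage, position] at hs
  split_ifs at hs
  · exact Or.inl hs
  · exact Or.inr hs

theorem speed_pos (x : ℝ) : 0 < speed cL cR x₀ x := by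
  unfold speed
  split_ifs
  exacts [h.left_pos, h.right_pos]

omit h in
theorem hasDerivAt_travelTime {x : ℝ} (hx : x ≠ x₀) :
    HasDerivAt (travelTime cL cR x₀) (speed cL cR x₀ x)⁻¹ x := by
  rcases lt_or_gt_of_ne hx with hx | hx
  · have h1 : HasDerivAt (fun y => y / cL) (1 / cL) x := (hasDerivAt_id x).div_const cL
    simp only [speed, if_pos hx, ← one_div]
    refine h1.congr_of_eventuallyEq ?_
    filter_upwards [Iio_mem_nhds hx] with y (hy : y < x₀)
    simp [travelTime, hy.le]
  · have h1 : HasDerivAt (fun y => x₀ / cL + (y - x₀) / cR) (1 / cR) x :=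
      (((hasDerivAt_id x).sub_const x₀).div_const cR).const_add _
    simp only [speed, if_neg hx.le.not_gt, ← one_div]
    refine h1.congr_of_eventuallyEq ?_
    filter_upwards [Ioi_mem_nhds hx] with y (hy : x₀ < y)
    simp [travelTime, hy.not_ge]

theorem integral_inv_speed (x : ℝ) :
    ∫ y in (0 : ℝ)..x, (speed cL cR x₀ y)⁻¹ = travelTime cL cR x₀ x := by
  have hi : IntervalIntegrable (fun y => (speed cL cR x₀ y)⁻¹) volume 0 x := by
    have hc : IntervalIntegrable (fun _ : ℝ => max cL⁻¹ cR⁻¹) volume 0 x :=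
      intervalIntegrable_const
    refine hc.mono_fun (measurable_speed cL cR x₀).inv.aestronglyMeasurable
      (Eventually.of_forall fun y => ?_)
    refine le_trans ?_ (le_abs_self _)
    dsimp only
    rw [Real.norm_of_nonneg (inv_pos.2 (h.speed_pos y)).le]
    unfold speed
    split_ifs
    exacts [le_max_left _ _, le_max_right _ _]
  have := integral_eq_of_hasDerivAt_off_countable (travelTime cL cR x₀)
    (fun y => (speed cL cR x₀ y)⁻¹) (a := 0) (b := x) (countable_singleton x₀)
    h.continuous_travelTime.continuousOn (fun y hy => hasDerivAt_travelTime hy.2) hi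
  rw [this, h.travelTime_zero, sub_zero]

/-! ### Convergence of the regularized characteristics -/

theorem tendsto_charTime {ι : Type*} {l : Filter ι} [l.IsCountablyGenerated] {c : ι → ℝ → ℝ}
    {m M : ℝ} (hc : ∀ᶠ i in l, IsSpeed (c i) m M)
    (hlim : ∀ x, x ≠ x₀ → Tendsto (fun i => c i x) l (𝓝 (speed cL cR x₀ x))) (x : ℝ) :
    Tendsto (fun i => charTime (c i) x) l (𝓝 (travelTime cL cR x₀ x)) := by
  rw [← h.integral_inv_speed]
  refine intervalIntegral.tendsto_integral_filter_of_dominated_convergence (fun _ => m⁻¹) ?_ ?_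
    intervalIntegrable_const ?_
  · filter_upwards [hc] with i hi using hi.contDiff_inv.continuous.aestronglyMeasurable
  · filter_upwards [hc] with i hi
    refine Eventually.of_forall fun y _ => ?_
    rw [Real.norm_of_nonneg (inv_pos.2 (hi.speed_pos y)).le]
    exact inv_anti₀ hi.pos (hi.lower y)
  · filter_upwards [Measure.ae_ne volume x₀] with y hy _
    exact (hlim y hy).inv₀ (h.speed_pos y).ne'

/-- The characteristics converge, because the inverse functions of the travel times are uniformly
Lipschitz continuous. -/
theorem tendsto_charPos {ι : Type*} {l : Filter ι} [l.IsCountablyGenerated] {c : ι → ℝ → ℝ}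
    {m M : ℝ} (hc : ∀ᶠ i in l, IsSpeed (c i) m M)
    (hlim : ∀ x, x ≠ x₀ → Tendsto (fun i => c i x) l (𝓝 (speed cL cR x₀ x))) {S : ι → ℝ} {s : ℝ}
    (hS : Tendsto S l (𝓝 s)) :
    Tendsto (fun i => charPos (c i) (S i)) l (𝓝 (position cL cR x₀ s)) := by
  have h1 := h.tendsto_charTime hc hlim (position cL cR x₀ s)
  rw [h.travelTime_position] at h1
  have h2 : Tendsto (fun i => M * |S i - charTime (c i) (position cL cR x₀ s)|) l (𝓝 0) := by
    simpa using ((hS.sub h1).abs).const_mul M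
  rw [tendsto_iff_dist_tendsto_zero]
  refine squeeze_zero' (Eventually.of_forall fun i => dist_nonneg) ?_ h2
  filter_upwards [hc] with i hi
  have h3 := hi.abs_charPos_sub_le (charTime (c i) (position cL cR x₀ s)) (S i)
  rwa [hi.charPos_charTime] at h3

/-! ### The classical solution -/

theorem classicalV_eq (v₀ : ℝ → ℂ) {x t : ℝ} (hx : 0 ≤ x) (ht : 0 ≤ t) :
    classicalV cL cR x₀ v₀ (x, t)
      = (Ici (0 : ℝ)).indicator v₀ (position cL cR x₀ (travelTime cL cR x₀ x + t)) := by
  have h1 := h.position_nonneg (add_nonneg (h.travelTime_nonneg hx) ht)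
  rw [indicator_of_mem (mem_Ici.2 h1)]
  simp [classicalV, γ₂]

/-- The solution `u` as the superposition of the wave that issues from the initial line and the
wave that issues from the boundary; at every point at most one of them does not vanish. -/
theorem classicalU_eq {u₀ v₀ : ℝ → ℂ} {δ B δ' B' : ℝ} (hu : IsDatum u₀ δ B)
    (hv : IsDatum v₀ δ' B') (x t : ℝ) :
    classicalU cL cR x₀ u₀ v₀ (x, t)
      = (Ici (0 : ℝ)).indicator u₀ (position cL cR x₀ (travelTime cL cR x₀ x - t))
        + (Ici (0 : ℝ)).indicator v₀ (position cL cR x₀ (t - travelTime cL cR x₀ x)) := by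
  unfold classicalU
  split_ifs with hc
  · have hc' : t ≤ travelTime cL cR x₀ x := hc
    rw [hv.indicator_eq_zero ((h.position_nonpos (by linarith)).trans_lt hv.pos), add_zero,
      indicator_of_mem (mem_Ici.2 (h.position_nonneg (by linarith)))]
    simp [γ₁, sub_eq_add_neg]
  · have hc' : travelTime cL cR x₀ x < t := not_le.1 hc
    rw [hu.indicator_eq_zero ((h.position_nonpos (by linarith)).trans_lt hu.pos), zero_add,
      h.classicalV_eq v₀ le_rfl (sub_pos.2 hc').le, h.travelTime_zero, zero_add]

theorem travelTime_left {x s : ℝ} (hs : 0 ≤ s) (hx : x + cL * s < x₀) :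
    travelTime cL cR x₀ (x + cL * s) = travelTime cL cR x₀ x + s := by
  have h1 := h.left_pos
  have h2 : 0 ≤ cL * s := by positivity
  rw [travelTime, travelTime, if_pos hx.le, if_pos (by linarith)]
  field_simp

theorem travelTime_right {x s : ℝ} (hs : 0 ≤ s) (hx : x₀ < x) :
    travelTime cL cR x₀ (x + cR * s) = travelTime cL cR x₀ x + s := by
  have h1 := h.right_pos
  have h2 : 0 ≤ cR * s := by positivity
  rw [travelTime, travelTime, if_neg (by linarith), if_neg (by linarith)]
  field_simp
  ring

theorem ae_continuousAt_position {w : ℝ → ℂ} {δ B : ℝ} (hw : IsDatum w δ B) :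
    ∀ᵐ s, ContinuousAt ((Ici (0 : ℝ)).indicator w) (position cL cR x₀ s) :=
  h.quasiMeasurePreserving_position.ae hw.ae_continuousAt

theorem isTransmissionSolution {u₀ v₀ : ℝ → ℂ} {δ B δ' B' : ℝ} (hu : IsDatum u₀ δ B)
    (hv : IsDatum v₀ δ' B') : IsTransmissionSolution cL cR x₀ u₀ v₀
      (classicalU cL cR x₀ u₀ v₀) (classicalV cL cR x₀ v₀) where
  left_u x t s _ _ hs hx := by
    rw [h.classicalU_eq hu hv, h.classicalU_eq hu hv, h.travelTime_left hs hx]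
    ring_nf
  right_u x t s hx _ hs := by
    rw [h.classicalU_eq hu hv, h.classicalU_eq hu hv, h.travelTime_right hs hx]
    ring_nf
  left_v x t s _ _ hs hx := by
    simp only [classicalV, γ₂, h.travelTime_left hs hx]
    ring_nf
  right_v x t s hx _ hs := by
    simp only [classicalV, γ₂, h.travelTime_right hs hx]
    ring_nf
  initial_u x hx := by
    have h1 := h.travelTime_nonneg hx
    rw [h.classicalU_eq hu hv, sub_zero, h.position_travelTime, indicator_of_mem (mem_Ici.2 hx),
      hv.indicator_eq_zero ((h.position_nonpos (by linarith)).trans_lt hv.pos), add_zero]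
  initial_v x hx := by
    rw [h.classicalV_eq v₀ hx le_rfl, add_zero, h.position_travelTime,
      indicator_of_mem (mem_Ici.2 hx)]
  boundary t ht := by
    rw [h.classicalV_eq v₀ le_rfl ht, h.classicalU_eq hu hv, h.travelTime_zero,
      hu.indicator_eq_zero ((h.position_nonpos (by linarith)).trans_lt hu.pos)]
    simp
  continuous_u := by
    refine ae_restrict_of_ae ?_
    have q1 := (quasiMeasurePreserving_sub_left volume (travelTime cL cR x₀ x₀)).ae
      (h.ae_continuousAt_position hu)
    have q2 := (measurePreserving_sub_right volume
      (travelTime cL cR x₀ x₀)).quasiMeasurePreserving.ae (h.ae_continuousAt_position hv)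
    filter_upwards [q1, q2] with t h1 h2
    have hT := h.continuous_travelTime
    have hP := h.continuous_position
    have e1 : ContinuousAt (fun x => position cL cR x₀ (travelTime cL cR x₀ x - t)) x₀ := by
      fun_prop
    have e2 : ContinuousAt (fun x => position cL cR x₀ (t - travelTime cL cR x₀ x)) x₀ := by
      fun_prop
    simp only [h.classicalU_eq hu hv]
    exact (ContinuousAt.comp (x := x₀) (g := (Ici (0 : ℝ)).indicator u₀)
      (f := fun x => position cL cR x₀ (travelTime cL cR x₀ x - t)) h1 e1).add
      (ContinuousAt.comp (x := x₀) (g := (Ici (0 : ℝ)).indicator v₀)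
      (f := fun x => position cL cR x₀ (t - travelTime cL cR x₀ x)) h2 e2)
  continuous_v := by
    have q := (measurePreserving_add_left volume
      (travelTime cL cR x₀ x₀)).quasiMeasurePreserving.ae (h.ae_continuousAt_position hv)
    filter_upwards [ae_restrict_of_ae q, ae_restrict_mem measurableSet_Ici] with t h1 ht
    have hT := h.continuous_travelTime
    have hP := h.continuous_position
    have e1 : ContinuousAt (fun x => position cL cR x₀ (travelTime cL cR x₀ x + t)) x₀ := by
      fun_prop
    refine (ContinuousAt.comp (x := x₀) (g := (Ici (0 : ℝ)).indicator v₀)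
      (f := fun x => position cL cR x₀ (travelTime cL cR x₀ x + t)) h1 e1).congr ?_
    filter_upwards [Ici_mem_nhds h.interface_pos] with x hx
    exact (h.classicalV_eq v₀ hx ht).symm

end IsMedium

/-! ### The system for representatives -/

theorem IsSmooth.sub {E : Type*} [NormedAddCommGroup E] [NormedSpace ℝ E] {Ω : Domain E}
    {u v : Index → E → ℂ} (hu : IsSmooth Ω u) (hv : IsSmooth Ω v) : IsSmooth Ω (u - v) :=
  fun φ => (hu φ).sub (hv φ)

theorem transportOp_sub (κ : Index → ℝ → ℝ) (σ : ℝ) {u v : Index → ℝ × ℝ → ℂ}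
    (hu : IsSmooth quadrant u) (hv : IsSmooth quadrant v) (φ : Index) :
    EqOn (transportOp κ σ (u - v) φ) ((transportOp κ σ u - transportOp κ σ v) φ)
      quadrant.carrier := fun p hp => by
  have h1 : fderivWithin ℝ (u φ - v φ) quadrant.carrier p = _ :=
    fderivWithin_sub (quadrant.uniqueDiff p hp) ((hu φ).differentiableOn (by simp) p hp)
      ((hv φ).differentiableOn (by simp) p hp)
  simp only [transportOp, fieldX, dirDeriv, Pi.add_apply, Pi.sub_apply, Pi.mul_apply, Pi.smul_apply,
    h1, sub_apply, smul_eq_mul]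
  ring

theorem mk_eq_zero_iff {E : Type*} [NormedAddCommGroup E] [NormedSpace ℝ E] {Ω : Domain E}
    {u : Moderate Ω} : Ideal.Quotient.mk (Negligible Ω) u = 0 ↔ Growth (fun q => (q : ℤ)) Ω u.1 :=
  Ideal.Quotient.eq_zero_iff_mem

/-- The wave system in `G`, in terms of representatives. -/
theorem isSolution_mk_iff {κ : Index → ℝ → ℝ}
    (hc : (fun φ x => (κ φ x : ℂ)) ∈ Moderate halfLine) (u₀ v₀ : Moderate halfLine)
    (u v : Moderate quadrant) :
    IsSolution (Ideal.Quotient.mk (Negligible halfLine) ⟨_, hc⟩)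
      (Ideal.Quotient.mk (Negligible halfLine) u₀) (Ideal.Quotient.mk (Negligible halfLine) v₀)
      (Ideal.Quotient.mk (Negligible quadrant) u) (Ideal.Quotient.mk (Negligible quadrant) v) ↔
    Growth (fun q => (q : ℤ)) quadrant (transportOp κ 1 u.1) ∧
    Growth (fun q => (q : ℤ)) quadrant (transportOp κ (-1) v.1) ∧
    Growth (fun q => (q : ℤ)) halfLine ((fun φ x => u.1 φ (x, 0)) - u₀.1) ∧
    Growth (fun q => (q : ℤ)) halfLine ((fun φ x => v.1 φ (x, 0)) - v₀.1) ∧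
    Growth (fun q => (q : ℤ)) halfLine
      ((fun φ t => u.1 φ (0, t)) - fun φ t => v.1 φ (0, t)) := by
  have e1 : ∀ w : Moderate quadrant, dt (Ideal.Quotient.mk (Negligible quadrant) w)
      + ofX (Ideal.Quotient.mk (Negligible halfLine) ⟨_, hc⟩)
        * dx (Ideal.Quotient.mk (Negligible quadrant) w) = 0 ↔
      Growth (fun q => (q : ℤ)) quadrant (transportOp κ 1 w.1) := fun w => by
    refine (mk_eq_zero_iff (u := derivModerate quadrant (0, 1) w
      + pullModerate (Ω := quadrant) (Ω' := halfLine)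
        (ContinuousLinearMap.fst ℝ ℝ ℝ) (fun _ hp => hp.1) ⟨_, hc⟩
        * derivModerate quadrant (1, 0) w)).trans ?_
    have e : (transportOp κ 1 w.1) = (derivModerate quadrant (0, 1) w
      + pullModerate (Ω := quadrant) (Ω' := halfLine) (ContinuousLinearMap.fst ℝ ℝ ℝ)
        (fun _ hp => hp.1) ⟨_, hc⟩ * derivModerate quadrant (1, 0) w).1 := by
      simp only [transportOp, Complex.ofReal_one, one_smul]
      rfl
    rw [e]
  have e2 : ∀ w : Moderate quadrant, dt (Ideal.Quotient.mk (Negligible quadrant) w)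
      - ofX (Ideal.Quotient.mk (Negligible halfLine) ⟨_, hc⟩)
        * dx (Ideal.Quotient.mk (Negligible quadrant) w) = 0 ↔
      Growth (fun q => (q : ℤ)) quadrant (transportOp κ (-1) w.1) := fun w => by
    refine (mk_eq_zero_iff (u := derivModerate quadrant (0, 1) w
      - pullModerate (Ω := quadrant) (Ω' := halfLine)
        (ContinuousLinearMap.fst ℝ ℝ ℝ) (fun _ hp => hp.1) ⟨_, hc⟩
        * derivModerate quadrant (1, 0) w)).trans ?_
    have e : (transportOp κ (-1) w.1) = (derivModerate quadrant (0, 1) w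
      - pullModerate (Ω := quadrant) (Ω' := halfLine) (ContinuousLinearMap.fst ℝ ℝ ℝ)
        (fun _ hp => hp.1) ⟨_, hc⟩ * derivModerate quadrant (1, 0) w).1 := by
      simp only [transportOp, Complex.ofReal_neg, Complex.ofReal_one, neg_smul, one_smul,
        ← sub_eq_add_neg]
      rfl
    rw [e]
  have e3 : ∀ (w : Moderate quadrant) (w₀ : Moderate halfLine),
      atTimeZero (Ideal.Quotient.mk (Negligible quadrant) w)
        = Ideal.Quotient.mk (Negligible halfLine) w₀ ↔
      Growth (fun q => (q : ℤ)) halfLine ((fun φ x => w.1 φ (x, 0)) - w₀.1) := fun w w₀ =>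
    mk_eq_mk_iff (u := pullModerate (Ω := halfLine) (Ω' := quadrant)
      (ContinuousLinearMap.inl ℝ ℝ ℝ)
      (fun _ hx => ⟨hx, le_refl (0 : ℝ)⟩) w)
  have e4 : atBoundary (Ideal.Quotient.mk (Negligible quadrant) u)
        = atBoundary (Ideal.Quotient.mk (Negligible quadrant) v) ↔
      Growth (fun q => (q : ℤ)) halfLine
        ((fun φ t => u.1 φ (0, t)) - fun φ t => v.1 φ (0, t)) :=
    mk_eq_mk_iff (u := pullModerate (Ω := halfLine) (Ω' := quadrant)
      (ContinuousLinearMap.inr ℝ ℝ ℝ)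
      (fun _ ht => ⟨le_refl (0 : ℝ), ht⟩) u) (v := pullModerate (Ω := halfLine) (Ω' := quadrant)
      (ContinuousLinearMap.inr ℝ ℝ ℝ)
      (fun _ ht => ⟨le_refl (0 : ℝ), ht⟩) v)
  rw [← e1, ← e2, ← e3, ← e3, ← e4]
  exact ⟨fun h => ⟨h.1, h.2, h.3, h.4, h.5⟩, fun h => ⟨h.1, h.2.1, h.2.2.1, h.2.2.2.1, h.2.2.2.2⟩⟩

/-- Solutions of the wave system in `G` are unique: the difference of two solutions has negligible
data and right-hand sides. -/
theorem IsSpeedFamily.isSolution_unique {κ : Index → ℝ → ℝ} {m M : ℝ} (hκ : IsSpeedFamily κ m M)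
    (hc : (fun φ x => (κ φ x : ℂ)) ∈ Moderate halfLine) {U₀ V₀ : G halfLine}
    {U V U' V' : G quadrant}
    (h : IsSolution (Ideal.Quotient.mk (Negligible halfLine) ⟨_, hc⟩) U₀ V₀ U V)
    (h' : IsSolution (Ideal.Quotient.mk (Negligible halfLine) ⟨_, hc⟩) U₀ V₀ U' V') :
    U' = U ∧ V' = V := by
  obtain ⟨u₀, rfl⟩ := Ideal.Quotient.mk_surjective U₀
  obtain ⟨v₀, rfl⟩ := Ideal.Quotient.mk_surjective V₀
  obtain ⟨u, rfl⟩ := Ideal.Quotient.mk_surjective U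
  obtain ⟨v, rfl⟩ := Ideal.Quotient.mk_surjective V
  obtain ⟨u', rfl⟩ := Ideal.Quotient.mk_surjective U'
  obtain ⟨v', rfl⟩ := Ideal.Quotient.mk_surjective V'
  rw [isSolution_mk_iff] at h h'
  obtain ⟨a1, a2, a3, a4, a5⟩ := h
  obtain ⟨b1, b2, b3, b4, b5⟩ := h'
  have su := u.2.1
  have sv := v.2.1
  have su' := u'.2.1
  have sv' := v'.2.1
  have su0 := IsSmooth.sub (isSmooth_initial su) u₀.2.1
  have sv0 := IsSmooth.sub (isSmooth_initial sv) v₀.2.1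
  have su0' := IsSmooth.sub (isSmooth_initial su') u₀.2.1
  have sv0' := IsSmooth.sub (isSmooth_initial sv') v₀.2.1
  have hV : Growth (fun q => (q : ℤ)) quadrant (v'.1 - v.1) := by
    refine hκ.growth_of_leftward (sv'.sub sv) ?_ ?_
    · exact (Growth.sub (hκ.isSmooth_transportOp sv' _) (hκ.isSmooth_transportOp sv _) b2 a2).congr'
        (transportOp_sub κ (-1) sv' sv)
    · exact (Growth.sub sv0' sv0 b4 a4).congr' fun φ x _ => by simp
  have hU : Growth (fun q => (q : ℤ)) quadrant (u'.1 - u.1) := by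
    refine hκ.growth_of_rightward (su'.sub su) ?_ ?_ ?_
    · exact (Growth.sub (hκ.isSmooth_transportOp su' _) (hκ.isSmooth_transportOp su _) b1 a1).congr'
        (transportOp_sub κ 1 su' su)
    · exact (Growth.sub su0' su0 b3 a3).congr' fun φ x _ => by simp
    -- On the boundary, `u' - u = (u' - v') - (u - v) + (v' - v)`.
    · have hb := hV.pull (sv'.sub sv) (ContinuousLinearMap.inr ℝ ℝ ℝ) (Ω := halfLine)
        fun _ hx => ⟨le_refl (0 : ℝ), hx⟩
      have s1 := (isSmooth_boundary su').sub (isSmooth_boundary sv')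
      have s2 := (isSmooth_boundary su).sub (isSmooth_boundary sv)
      exact ((Growth.sub s1 s2 b5 a5).add (s1.sub s2) (isSmooth_boundary (sv'.sub sv))
        hb).congr'
        fun φ x _ => by
          simp only [Pi.sub_apply, Pi.add_apply]
          ring
  exact ⟨mk_eq_mk_iff.2 hU, mk_eq_mk_iff.2 hV⟩

/-! ### Explicit solutions -/

/-- The simple wave `f (T x + σ t)`, where `T` is the travel time of the speed `κ φ` (and zero for
the exceptional mollifiers for which `κ φ` vanishes). -/
def wave (κ : Index → ℝ → ℝ) (f : Index → ℝ → ℂ) (σ : ℝ) : Index → ℝ × ℝ → ℂ := fun φ p =>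
  open Classical in if κ φ = 0 then 0 else f φ (charTime (κ φ) p.1 + σ * p.2)

/-- The profile of the simple wave with initial values `d`; for `σ = 1` it travels to the left. -/
def profile (κ : Index → ℝ → ℝ) (d : Index → ℝ → ℂ) : Index → ℝ → ℂ := fun φ s =>
  d φ (charPos (κ φ) s)

/-- The profile of the simple wave travelling to the right (`σ = -1`) with initial values `d`, whose
boundary values are those of the wave with profile `profile κ e` travelling to the left.  This is so
when `d` and `e` vanish on the negative axis; no smoothness is lost at the corner when they vanish
near `0`. -/
def reflectedProfile (κ : Index → ℝ → ℝ) (d e : Index → ℝ → ℂ) : Index → ℝ → ℂ := fun φ s =>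
  profile κ d φ s + profile κ e φ (-s)

namespace IsSpeed

variable {c : ℝ → ℝ} {m M : ℝ} (h : IsSpeed c m M)
include h

theorem ne_zero : c ≠ 0 := fun h0 => by
  have := h.speed_pos 0
  simp [h0] at this

theorem fderivWithin_wave {f : ℝ → ℂ} (hf : Differentiable ℝ f) (σ : ℝ) {p : ℝ × ℝ}
    (hp : p ∈ quadrant.carrier) (e : ℝ × ℝ) :
    fderivWithin ℝ (fun p : ℝ × ℝ => f (charTime c p.1 + σ * p.2)) quadrant.carrier p e
      = ((c p.1)⁻¹ * e.1 + σ * e.2 : ℝ) • _root_.deriv f (charTime c p.1 + σ * p.2) := by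
  have h1 : HasFDerivAt (fun p : ℝ × ℝ => charTime c p.1) _ p :=
    (h.hasDerivAt_charTime p.1).hasFDerivAt.comp p (hasFDerivAt_fst (𝕜 := ℝ))
  have h2 : HasFDerivAt (fun p : ℝ × ℝ => σ * p.2) _ p :=
    (hasFDerivAt_snd (𝕜 := ℝ)).const_mul σ
  have h3 := ((hf (charTime c p.1 + σ * p.2)).hasDerivAt.hasFDerivAt.comp p
    (h1.add h2)).hasFDerivWithinAt (s := quadrant.carrier)
  have h4 := h3.fderivWithin (quadrant.uniqueDiff p hp)
  simp only [Function.comp_def, Pi.add_apply] at h4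
  rw [h4]
  simp
  ring

end IsSpeed

section

variable {κ : Index → ℝ → ℝ} {m M : ℝ}

theorem contDiff_profile {d : Index → ℝ → ℂ} (hd : ∀ φ, ContDiff ℝ ∞ (d φ)) (φ : Index)
    (hφ : IsSpeed (κ φ) m M) : ContDiff ℝ ∞ (profile κ d φ) := (hd φ).comp hφ.contDiff_charPos

theorem contDiff_reflectedProfile {d e : Index → ℝ → ℂ} (hd : ∀ φ, ContDiff ℝ ∞ (d φ))
    (he : ∀ φ, ContDiff ℝ ∞ (e φ)) (φ : Index) (hφ : IsSpeed (κ φ) m M) :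
    ContDiff ℝ ∞ (reflectedProfile κ d e φ) :=
  (contDiff_profile hd φ hφ).add ((contDiff_profile he φ hφ).comp contDiff_neg)

theorem wave_profile_initial (d : Index → ℝ → ℂ) {φ : Index} (hφ : IsSpeed (κ φ) m M) (x : ℝ) :
    wave κ (profile κ d) 1 φ (x, 0) = d φ x := by
  simp [wave, hφ.ne_zero, profile, hφ.charPos_charTime]

theorem wave_reflectedProfile_initial (d : Index → ℝ → ℂ) {e : Index → ℝ → ℂ}
    (he : ∀ φ x, x ≤ 0 → e φ x = 0) {φ : Index} (hφ : IsSpeed (κ φ) m M) {x : ℝ} (hx : 0 ≤ x) :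
    wave κ (reflectedProfile κ d e) (-1) φ (x, 0) = d φ x := by
  have h1 := he φ _ (hφ.charPos_nonpos (neg_nonpos.2 (hφ.charTime_nonneg hx)))
  simp [wave, hφ.ne_zero, reflectedProfile, profile, hφ.charPos_charTime, h1]

theorem wave_reflectedProfile_boundary {d : Index → ℝ → ℂ} (hd : ∀ φ x, x ≤ 0 → d φ x = 0)
    (e : Index → ℝ → ℂ) {φ : Index} (hφ : IsSpeed (κ φ) m M) {t : ℝ} (ht : 0 ≤ t) :
    wave κ (reflectedProfile κ d e) (-1) φ (0, t) = wave κ (profile κ e) 1 φ (0, t) := by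
  have h1 := hd φ _ (hφ.charPos_nonpos (neg_nonpos.2 ht))
  simp [wave, hφ.ne_zero, reflectedProfile, profile, h1]

end

namespace IsSpeedFamily

variable {κ : Index → ℝ → ℝ} {m M : ℝ} (h : IsSpeedFamily κ m M)
include h

theorem isSmooth_wave {f : Index → ℝ → ℂ} (hf : ∀ φ, IsSpeed (κ φ) m M → ContDiff ℝ ∞ (f φ))
    (σ : ℝ) : IsSmooth quadrant (wave κ f σ) := fun φ => by
  rcases h.zero_or_speed φ with h0 | h0
  · have : wave κ f σ φ = fun _ => 0 := by ext p; simp [wave, h0]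
    rw [this]
    exact contDiffOn_const
  · have : wave κ f σ φ = fun p => f φ (charTime (κ φ) p.1 + σ * p.2) := by
      ext p; simp [wave, h0.ne_zero]
    rw [this]
    exact ((hf φ h0).comp ((h0.contDiff_charTime.comp contDiff_fst).add
      (contDiff_const.mul contDiff_snd))).contDiffOn

/-- Simple waves solve the transport equation exactly, also for the exceptional mollifiers. -/
theorem transportOp_wave {f : Index → ℝ → ℂ} (hf : ∀ φ, IsSpeed (κ φ) m M → ContDiff ℝ ∞ (f φ))
    (σ : ℝ) (φ : Index) : EqOn (transportOp κ (-σ) (wave κ f σ) φ) 0 quadrant.carrier := by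
  intro p hp
  change fderivWithin ℝ (wave κ f σ φ) quadrant.carrier p (0, 1) + ((-σ : ℝ) : ℂ) *
    ((κ φ p.1 : ℂ) * fderivWithin ℝ (wave κ f σ φ) quadrant.carrier p (1, 0)) = 0
  rcases h.zero_or_speed φ with h0 | h0
  · have : wave κ f σ φ = fun _ => 0 := by ext p; simp [wave, h0]
    simp [this]
  · have : wave κ f σ φ = fun p => f φ (charTime (κ φ) p.1 + σ * p.2) := by
      ext p; simp [wave, h0.ne_zero]
    have hd := (hf φ h0).differentiable (by simp)
    have hne : (κ φ p.1 : ℂ) ≠ 0 := by exact_mod_cast (h0.speed_pos p.1).ne'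
    rw [this, h0.fderivWithin_wave hd σ hp, h0.fderivWithin_wave hd σ hp]
    simp
    field_simp
    ring

theorem wave_profile_mem {e : Index → ℝ → ℂ} (he : ∀ φ, ContDiff ℝ ∞ (e φ))
    (hem : Growth 0 halfLine e) : wave κ (profile κ e) 1 ∈ Moderate quadrant := by
  have hs := h.isSmooth_wave (contDiff_profile he) 1
  refine mem_moderate_iff.2 ⟨hs, h.growth_of_leftward hs ?_ ?_⟩
  · exact growth_of_eventually_zero fun φ => Eventually.of_forall fun ε =>
      h.transportOp_wave (contDiff_profile he) 1 _
  · exact hem.congr fun φ => (h.eventually_speed φ).mono fun ε hε x _ =>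
      wave_profile_initial e hε x

theorem wave_reflectedProfile_mem {d e : Index → ℝ → ℂ} (hd : ∀ φ, ContDiff ℝ ∞ (d φ))
    (he : ∀ φ, ContDiff ℝ ∞ (e φ)) (hdm : Growth 0 halfLine d) (hem : Growth 0 halfLine e)
    (hd0 : ∀ φ x, x ≤ 0 → d φ x = 0) (he0 : ∀ φ x, x ≤ 0 → e φ x = 0) :
    wave κ (reflectedProfile κ d e) (-1) ∈ Moderate quadrant := by
  have hf := contDiff_reflectedProfile (κ := κ) (m := m) (M := M) hd he
  have hs := h.isSmooth_wave hf (-1)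
  have hV := mem_moderate_iff.1 (h.wave_profile_mem he hem)
  refine mem_moderate_iff.2 ⟨hs, h.growth_of_rightward hs ?_ ?_ ?_⟩
  · exact growth_of_eventually_zero fun φ => Eventually.of_forall fun ε => by
      simpa using h.transportOp_wave hf (-1) (φ.scale ε)
  · exact hdm.congr fun φ => (h.eventually_speed φ).mono fun ε hε x hx =>
      wave_reflectedProfile_initial d he0 hε hx
  · exact (hV.2.pull hV.1 (ContinuousLinearMap.inr ℝ ℝ ℝ) (Ω := halfLine)
      fun _ hx => ⟨le_refl (0 : ℝ), hx⟩).congr fun φ => (h.eventually_speed φ).mono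
        fun ε hε t ht => wave_reflectedProfile_boundary hd0 e hε ht

theorem isSolution_wave (hc : (fun φ x => (κ φ x : ℂ)) ∈ Moderate halfLine) {d e : Index → ℝ → ℂ}
    (hd : ∀ φ, ContDiff ℝ ∞ (d φ)) (he : ∀ φ, ContDiff ℝ ∞ (e φ)) (hdm : d ∈ Moderate halfLine)
    (hem : e ∈ Moderate halfLine) (hd0 : ∀ φ x, x ≤ 0 → d φ x = 0)
    (he0 : ∀ φ x, x ≤ 0 → e φ x = 0)
    (hU : wave κ (reflectedProfile κ d e) (-1) ∈ Moderate quadrant)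
    (hV : wave κ (profile κ e) 1 ∈ Moderate quadrant) :
    IsSolution (Ideal.Quotient.mk (Negligible halfLine) ⟨_, hc⟩)
      (Ideal.Quotient.mk (Negligible halfLine) ⟨d, hdm⟩)
      (Ideal.Quotient.mk (Negligible halfLine) ⟨e, hem⟩)
      (Ideal.Quotient.mk (Negligible quadrant) ⟨_, hU⟩)
      (Ideal.Quotient.mk (Negligible quadrant) ⟨_, hV⟩) := by
  rw [isSolution_mk_iff]
  refine ⟨?_, ?_, ?_, ?_, ?_⟩ <;> refine growth_of_eventually_zero fun φ => ?_
  · exact Eventually.of_forall fun ε => by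
      simpa using h.transportOp_wave (contDiff_reflectedProfile hd he) (-1) (φ.scale ε)
  · exact Eventually.of_forall fun ε => h.transportOp_wave (contDiff_profile he) 1 _
  · filter_upwards [h.eventually_speed φ] with ε hε x hx
    simp [wave_reflectedProfile_initial d he0 hε hx]
  · filter_upwards [h.eventually_speed φ] with ε hε x hx
    simp [wave_profile_initial e hε x]
  · filter_upwards [h.eventually_speed φ] with ε hε t ht
    simp [wave_reflectedProfile_boundary hd0 e hε ht]

end IsSpeedFamily

/-! ### Association of the generalized solution with the classical one -/

namespace IsRegularizer

variable {cL cR x₀ : ℝ} {ρ : ℝ → ℝ} (h : IsRegularizer cL cR x₀ ρ) {m M : ℝ}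
  (hκ : IsSpeedFamily (fun φ => smear (speed cL cR x₀) ρ (logScale φ)) m M)
include h

theorem tendsto_smear (φ : Index) {x : ℝ} (hx : x ≠ x₀) :
    Tendsto (fun ε => smear (speed cL cR x₀) ρ (logScale (φ.scale ε)) x) (𝓝[>] 0)
      (𝓝 (speed cL cR x₀ x)) := by
  have h1 := (Complex.continuous_re.tendsto _).comp (h.tendsto_speedRep φ hx)
  simpa [Function.comp_def, speedRep] using h1

include hκ

theorem tendsto_charTime (φ : Index) (x : ℝ) :
    Tendsto (fun ε => charTime (smear (speed cL cR x₀) ρ (logScale (φ.scale ε))) x)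
      (𝓝[>] 0) (𝓝 (travelTime cL cR x₀ x)) :=
  h.toIsMedium.tendsto_charTime (hκ.eventually_speed φ) (fun _ hx => h.tendsto_smear φ hx) x

theorem tendsto_profile {w : ℝ → ℂ} {δ B : ℝ} (hw : IsDatum w δ B) (φ : Index) {S : ℝ → ℝ} {s : ℝ}
    (hS : Tendsto S (𝓝[>] 0) (𝓝 s))
    (hs : ContinuousAt ((Ici (0 : ℝ)).indicator w) (position cL cR x₀ s)) :
    Tendsto (fun ε => profile (fun φ => smear (speed cL cR x₀) ρ (logScale φ)) (cutData δ w)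
      (φ.scale ε) (S ε)) (𝓝[>] 0) (𝓝 ((Ici (0 : ℝ)).indicator w (position cL cR x₀ s))) :=
  hw.tendsto_cutData φ (h.toIsMedium.tendsto_charPos (hκ.eventually_speed φ)
    (fun _ hx => h.tendsto_smear φ hx) hS) hs

theorem isAssociated_classicalV {v₀ : ℝ → ℂ} {δ B : ℝ} (hv : IsDatum v₀ δ B) {V : G quadrant}
    (hV : IsRep (wave (fun φ => smear (speed cL cR x₀) ρ (logScale φ))
      (profile (fun φ => smear (speed cL cR x₀) ρ (logScale φ)) (cutData δ v₀)) 1) V) :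
    IsAssociated V (classicalV cL cR x₀ v₀) := by
  have hm : MeasurableSet quadrant.carrier := measurableSet_Ici.prod measurableSet_Ici
  have q := quasiMeasurePreserving_add_shear h.continuous_travelTime
  have hpos := h.toIsMedium.quasiMeasurePreserving_position
  have heq : (fun p : ℝ × ℝ => (Ici (0 : ℝ)).indicator v₀
      (position cL cR x₀ (travelTime cL cR x₀ p.1 + p.2)))
      =ᵐ[volume.restrict quadrant.carrier] classicalV cL cR x₀ v₀ := by
    filter_upwards [ae_restrict_mem hm] with p hp
    exact (h.classicalV_eq v₀ hp.1 hp.2).symm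
  refine isAssociated_of_tendsto hm hV ((hv.aestronglyMeasurable.comp_quasiMeasurePreserving
    (hpos.comp q)).restrict.congr heq) (B' := B) (fun p hp => ?_)
    (fun φ => ⟨B * ∫ y, ‖φ.1 y‖, ?_⟩) fun φ => ?_
  · rw [show p = (p.1, p.2) from rfl, h.classicalV_eq v₀ hp.1 hp.2]
    exact hv.norm_indicator_le _
  · filter_upwards [hκ.eventually_speed φ, hv.eventually_norm_cutData_le φ] with ε hε hb p _
    simpa [wave, hε.ne_zero, profile] using hb _
  · filter_upwards [heq, ae_restrict_of_ae (q.ae (h.ae_continuousAt_position hv))] with p hp hc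
    rw [← hp]
    refine (h.tendsto_profile hκ hv φ ((h.tendsto_charTime hκ φ p.1).add_const p.2) hc).congr' ?_
    filter_upwards [hκ.eventually_speed φ] with ε hε
    simp [wave, hε.ne_zero]

theorem isAssociated_classicalU {u₀ v₀ : ℝ → ℂ} {δ B δ' B' : ℝ} (hu : IsDatum u₀ δ B)
    (hv : IsDatum v₀ δ' B') {U : G quadrant}
    (hU : IsRep (wave (fun φ => smear (speed cL cR x₀) ρ (logScale φ))
      (reflectedProfile (fun φ => smear (speed cL cR x₀) ρ (logScale φ)) (cutData δ u₀)
        (cutData δ' v₀)) (-1)) U) :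
    IsAssociated U (classicalU cL cR x₀ u₀ v₀) := by
  have hm : MeasurableSet quadrant.carrier := measurableSet_Ici.prod measurableSet_Ici
  have q := quasiMeasurePreserving_sub_shear h.continuous_travelTime
  have q' : Measure.QuasiMeasurePreserving
      (fun p : ℝ × ℝ => p.2 - travelTime cL cR x₀ p.1) volume volume := by
    have := quasiMeasurePreserving_add_shear h.continuous_travelTime.neg
    simpa [← sub_eq_neg_add] using this
  have hpos := h.toIsMedium.quasiMeasurePreserving_position
  have heq : (fun p : ℝ × ℝ => (Ici (0 : ℝ)).indicator u₀
        (position cL cR x₀ (travelTime cL cR x₀ p.1 - p.2))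
      + (Ici (0 : ℝ)).indicator v₀ (position cL cR x₀ (p.2 - travelTime cL cR x₀ p.1)))
      = classicalU cL cR x₀ u₀ v₀ := by
    ext p
    exact (h.classicalU_eq hu hv p.1 p.2).symm
  rw [← heq]
  refine isAssociated_of_tendsto hm hU
    ((hu.aestronglyMeasurable.comp_quasiMeasurePreserving (hpos.comp q)).restrict.add
      (hv.aestronglyMeasurable.comp_quasiMeasurePreserving (hpos.comp q')).restrict)
    (B' := B + B') (fun p hp => ?_)
    (fun φ => ⟨B * (∫ y, ‖φ.1 y‖) + B' * ∫ y, ‖φ.1 y‖, ?_⟩) fun φ => ?_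
  · exact (norm_add_le _ _).trans (add_le_add (hu.norm_indicator_le _) (hv.norm_indicator_le _))
  · filter_upwards [hκ.eventually_speed φ, hu.eventually_norm_cutData_le φ,
      hv.eventually_norm_cutData_le φ] with ε hε hb hb' p _
    simp only [wave, hε.ne_zero, if_false]
    exact (norm_add_le _ _).trans (add_le_add (hb _) (hb' _))
  · filter_upwards [ae_restrict_of_ae (q.ae (h.ae_continuousAt_position hu)),
      ae_restrict_of_ae (q'.ae (h.ae_continuousAt_position hv))] with p hc hc'
    have hT := h.tendsto_charTime hκ φ p.1
    refine ((h.tendsto_profile hκ hu φ (hT.sub_const p.2) hc).add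
      (h.tendsto_profile hκ hv φ (hT.const_sub p.2) hc')).congr' ?_
    filter_upwards [hκ.eventually_speed φ] with ε hε
    simp [wave, hε.ne_zero, reflectedProfile, ← sub_eq_add_neg]

end IsRegularizer

end

end Colombeau

theorem proposition2
    (cL cR x₀ : ℝ) (hcL : 0 < cL) (hcR : 0 < cR) (hx₀ : 0 < x₀)
    (u₀ v₀ : ℝ → ℂ)
    (hu_bdd : ∃ M : ℝ, ∀ x, 0 ≤ x → ‖u₀ x‖ ≤ M)
    (hv_bdd : ∃ M : ℝ, ∀ x, 0 ≤ x → ‖v₀ x‖ ≤ M)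
    (hu_cont : ∀ᵐ x ∂volume.restrict (Ici (0 : ℝ)), ContinuousWithinAt u₀ (Ici 0) x)
    (hv_cont : ∀ᵐ x ∂volume.restrict (Ici (0 : ℝ)), ContinuousWithinAt v₀ (Ici 0) x)
    (hu_nil : ∃ δ > 0, ∀ x : ℝ, 0 ≤ x → x < δ → u₀ x = 0)
    (hv_nil : ∃ δ > 0, ∀ x : ℝ, 0 ≤ x → x < δ → v₀ x = 0)
    (ρ : ℝ → ℝ) (hρ_smooth : ContDiff ℝ ∞ ρ) (hρ_compact : HasCompactSupport ρ)
    (hρ_integral : ∫ x, ρ x = 1)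
    (hρ_pos : ∀ η : ℝ, 0 < η → ∀ x : ℝ, 0 < Colombeau.smear (Colombeau.speed cL cR x₀) ρ η x) :
    ∃ C U₀ V₀ : Colombeau.G Colombeau.halfLine,
      -- the regularized speed, with the properties of a generalized coefficient
      Colombeau.IsRep (Colombeau.speedRep (Colombeau.speed cL cR x₀) ρ) C ∧
      Colombeau.IsAssociated C (fun x => (Colombeau.speed cL cR x₀ x : ℂ)) ∧
      Colombeau.GloballyBounded C ∧ Colombeau.LocallyLogGrowth (Colombeau.deriv (1 : ℝ) C) ∧
      -- the initial data as generalized functions, satisfying the compatibility conditions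
      Colombeau.IsRep (Colombeau.dataRep u₀) U₀ ∧ Colombeau.IsAssociated U₀ u₀ ∧
      Colombeau.NilNearZero U₀ ∧
      Colombeau.IsRep (Colombeau.dataRep v₀) V₀ ∧ Colombeau.IsAssociated V₀ v₀ ∧
      Colombeau.NilNearZero V₀ ∧
      -- the classical solution
      Colombeau.IsTransmissionSolution cL cR x₀ u₀ v₀
        (Colombeau.classicalU cL cR x₀ u₀ v₀) (Colombeau.classicalV cL cR x₀ v₀) ∧
      -- existence, uniqueness and association
      ∃ U V : Colombeau.G Colombeau.quadrant,
        Colombeau.IsSolution C U₀ V₀ U V ∧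
        (∀ U' V' : Colombeau.G Colombeau.quadrant,
          Colombeau.IsSolution C U₀ V₀ U' V' → U' = U ∧ V' = V) ∧
        Colombeau.IsAssociated U (Colombeau.classicalU cL cR x₀ u₀ v₀) ∧
        Colombeau.IsAssociated V (Colombeau.classicalV cL cR x₀ v₀) := by
  obtain ⟨B, hB⟩ := hu_bdd
  obtain ⟨B', hB'⟩ := hv_bdd
  obtain ⟨δ, hδ, hδu⟩ := hu_nil
  obtain ⟨δ', hδ', hδv⟩ := hv_nil
  have hu : Colombeau.IsDatum u₀ δ B := ⟨hδ, hB, hu_cont, hδu⟩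
  have hv : Colombeau.IsDatum v₀ δ' B' := ⟨hδ', hB', hv_cont, hδv⟩
  have h : Colombeau.IsRegularizer cL cR x₀ ρ :=
    ⟨⟨hcL, hcR, hx₀⟩, hρ_smooth, hρ_compact, hρ_integral, hρ_pos⟩
  obtain ⟨m, M, hκ⟩ := h.exists_isSpeedFamily
  have hu_zero : ∀ φ x, x ≤ 0 → Colombeau.cutData δ u₀ φ x = 0 := fun φ x hx =>
    hu.cutData_eq_zero φ (hx.trans_lt (half_pos hδ))
  have hv_zero : ∀ φ x, x ≤ 0 → Colombeau.cutData δ' v₀ φ x = 0 := fun φ x hx =>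
    hv.cutData_eq_zero φ (hx.trans_lt (half_pos hδ'))
  have hV := hκ.wave_profile_mem hv.contDiff_cutData (Colombeau.mem_moderate_iff.1 hv.cutData_mem).2
  have hU := hκ.wave_reflectedProfile_mem hu.contDiff_cutData hv.contDiff_cutData
    (Colombeau.mem_moderate_iff.1 hu.cutData_mem).2 (Colombeau.mem_moderate_iff.1 hv.cutData_mem).2
    hu_zero hv_zero
  have hsol := hκ.isSolution_wave h.speedRep_mem hu.contDiff_cutData hv.contDiff_cutData
    hu.cutData_mem hv.cutData_mem hu_zero hv_zero hU hV
  rw [hu.mk_cutData, hv.mk_cutData] at hsol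
  exact ⟨_, _, _, ⟨h.speedRep_mem, rfl⟩, h.isAssociated_speed, h.globallyBounded_speed,
    h.locallyLogGrowth_speed, ⟨hu.dataRep_mem, rfl⟩, hu.isAssociated, hu.nilNearZero,
    ⟨hv.dataRep_mem, rfl⟩, hv.isAssociated, hv.nilNearZero, h.isTransmissionSolution hu hv,
    _, _, hsol, fun U' V' h' => hκ.isSolution_unique h.speedRep_mem hsol h',
    h.isAssociated_classicalU hκ hu hv ⟨hU, rfl⟩, h.isAssociated_classicalV hκ hv ⟨hV, rfl⟩⟩
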